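/- Let $n\ge 0$ and $[n]=\{1,\dots,n\}$. We consider partial orders $P=([n],\preceq_P)$. **Regular posets.** $P$ is *regular* if for all $x,y,z\in[n]$ with $x\preceq_P z$ and ($x<y<z$ or $z<y<x$) one has $x\preceq_P y$ or $y\preceq_P z$. **Schur labeled skew shape posets.** A skew partition $\lambda/\mu$ is a pair of partitions with $\mu\subseteq\lambda$. Its Young diagram (English convention) is that of $\lambda$ with the boxes of $\mu$ removed, and it is *basic* if this diagram has no empty row and no empty column. A *Schur labeling* $\tau$ of shape $\mathrm{sh}(\tau)=\lambda/\mu$, where $|\lambda/\mu|=n$, is a bijective filling of the boxes by $[n]$ whose rows decrease from left to right and whose columns increase from top to bottom. It defines the poset $\mathrm{poset}(\tau)$ on $[n]$ in which $i\preceq j$ if and only if the box of $i$ lies weakly above and weakly to the left of the box of $j$. $P$ is a *Schur labeled skew shape poset* if $P=\mathrm{poset}(\tau)$ for some Schur labeling $\tau$ of basic shape. For such $P$ let $\tau_P$ be the unique Schur labeling of basic shape with $\mathrm{poset}(\tau_P)=P$ such that the minimal entries of the connected components of its diagram increase from the top component to the bottom one. **The modules $\mathsf M_P$.** The $0$-Hecke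 algebra $H_n(0)$ is the unital associative $\mathbb C$-algebra generated by $\pi_1,\dots,\pi_{n-1}$ with relations $\pi_i^2=\pi_i$, $\pi_i\pi_{i+1}\pi_i=\pi_{i+1}\pi_i\pi_{i+1}$, and $\pi_i\pi_j=\pi_j\pi_i$ for $|i-j|\ge2$. Let $s_i=(i,i+1)$, let $\ell$ be the length function of the symmetric group $\mathfrak S_n$, and let $\mathrm{Des}_L(\gamma)=\{i:\ell(s_i\gamma)<\ell(\gamma)\}$. Let $\Sigma_L(P)$ be the set of all $\sigma\in\mathfrak S_n$ such that $\sigma(i)\le\sigma(j)$ whenever $i\preceq_P j$. Then $\mathsf M_P$ is the left $H_n(0)$-module with $\mathbb C$-basis $\Sigma_L(P)$ and, for $\gamma\in\Sigma_L(P)$, $$\pi_i\cdot\gamma=\begin{cases}\gamma & \text{if } i\in \mathrm{Des}_L(\gamma),\\ 0 & \text{if } i\notin \mathrm{Des}_L(\gamma)\text{ and } s_i\gamma\notin\Sigma_L(P),\\ s_i\gamma & \text{if } i\notin \mathrm{Des}_L(\gamma)\text{ and } s_i\gamma\in\Sigma_L(P).\end{cases}$$ **Theorem.** Let $P$ and $Q$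 be regular Schur labeled skew shape posets on $[n]$. Then $\mathsf M_P\cong\mathsf M_Q$ as $H_n(0)$-modules if and only if $\mathrm{sh}(\tau_P)=\mathrm{sh}(\tau_Q)$. -/

import Mathlib

namespace RSP

/-- The simple transposition exchanging `i` and `i + 1` (labels are counted from `0`). -/
def simpleTransposition {n : ℕ} (i : Fin (n - 1)) : Equiv.Perm (Fin n) :=
  Equiv.swap ⟨i, by omega⟩ ⟨i + 1, by omega⟩

/-- The length of `σ`: the least number of simple transpositions in a word for `σ`. -/
noncomputable def permLength {n : ℕ} (σ : Equiv.Perm (Fin n)) : ℕ :=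
  sInf {k | ∃ w : List (Fin (n - 1)), w.length = k ∧ (w.map simpleTransposition).prod = σ}

/-- The left descent set of `σ`: all `i` such that `s_i σ` is shorter than `σ`. -/
def leftDescents {n : ℕ} (σ : Equiv.Perm (Fin n)) : Set (Fin (n - 1)) :=
  {i | permLength (simpleTransposition i * σ) < permLength σ}

section Length

variable {n : ℕ}

/-- The inversions of `σ`; their number is the length of `σ`. -/
def inversions (σ : Equiv.Perm (Fin n)) : Finset (Fin n × Fin n) :=
  Finset.univ.filter fun p => p.1 < p.2 ∧ σ p.2 < σ p.1

theorem mem_inversions (σ : Equiv.Perm (Fin n)) (a b : Fin n) :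
    (a, b) ∈ inversions σ ↔ (a : ℕ) < b ∧ (σ b : ℕ) < σ a := by
  simp [inversions]

theorem simpleTransposition_apply_val (i : Fin (n - 1)) (x : Fin n) :
    (simpleTransposition i x : ℕ) =
      if (x : ℕ) = i then (i : ℕ) + 1 else if (x : ℕ) = i + 1 then (i : ℕ) else x := by
  unfold simpleTransposition
  rw [Equiv.swap_apply_def]
  simp only [Fin.ext_iff]
  split_ifs <;> rfl

theorem simpleTransposition_mul_self (i : Fin (n - 1)) :
    simpleTransposition i * simpleTransposition i = 1 :=
  Equiv.swap_mul_self _ _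

theorem card_inversions_mul (i : Fin (n - 1)) (σ : Equiv.Perm (Fin n))
    (h : σ⁻¹ ⟨i, by omega⟩ < σ⁻¹ ⟨i + 1, by omega⟩) :
    (inversions (simpleTransposition i * σ)).card = (inversions σ).card + 1 := by
  have key : inversions (simpleTransposition i * σ) =
      insert (σ⁻¹ ⟨i, by omega⟩, σ⁻¹ ⟨i + 1, by omega⟩) (inversions σ) := by
    ext ⟨a, b⟩
    simp only [mem_inversions, Finset.mem_insert,
      Prod.mk.injEq, Equiv.Perm.mul_apply, simpleTransposition_apply_val,
      Equiv.Perm.eq_inv_iff_eq, Fin.ext_iff]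
    have h1 : ∀ c : Fin n, (σ c : ℕ) = i → c = σ⁻¹ ⟨i, by omega⟩ := fun c hc => by
      rw [Equiv.Perm.eq_inv_iff_eq]; exact Fin.ext hc
    have h2 : ∀ c : Fin n, (σ c : ℕ) = i + 1 → c = σ⁻¹ ⟨i + 1, by omega⟩ := fun c hc => by
      rw [Equiv.Perm.eq_inv_iff_eq]; exact Fin.ext hc
    have h3 : (σ a : ℕ) = σ b → a = b := fun hc => σ.injective (Fin.ext hc)
    have hl : (σ a : ℕ) = i → (σ b : ℕ) = i + 1 → a < b := fun x y => by
      rw [h1 a x, h2 b y]; exact h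
    have hr : (σ a : ℕ) = i + 1 → (σ b : ℕ) = i → b < a := fun x y => by
      rw [h1 b y, h2 a x]; exact h
    simp only [Fin.lt_def] at hl hr
    constructor
    · rintro ⟨hab, hlt⟩
      split_ifs at hlt <;> omega
    · rintro (⟨ha, hb⟩ | ⟨hab, hlt⟩)
      · refine ⟨hl ha hb, ?_⟩
        rw [ha, hb]; simp
      · refine ⟨hab, ?_⟩
        split_ifs <;> omega
  rw [key, Finset.card_insert_of_notMem]
  simp [mem_inversions]

theorem card_inversions_mul_of_gt (i : Fin (n - 1)) (σ : Equiv.Perm (Fin n))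
    (h : σ⁻¹ ⟨i + 1, by omega⟩ < σ⁻¹ ⟨i, by omega⟩) :
    (inversions σ).card = (inversions (simpleTransposition i * σ)).card + 1 := by
  have := card_inversions_mul i (simpleTransposition i * σ) (by
    rw [mul_inv_rev, Equiv.Perm.mul_apply, Equiv.Perm.mul_apply]
    simpa [simpleTransposition] using h)
  rwa [← mul_assoc, simpleTransposition_mul_self, one_mul] at this

theorem inv_lt_or_gt (i : Fin (n - 1)) (σ : Equiv.Perm (Fin n)) :
    σ⁻¹ ⟨i, by omega⟩ < σ⁻¹ ⟨i + 1, by omega⟩ ∨ σ⁻¹ ⟨i + 1, by omega⟩ < σ⁻¹ ⟨i, by omega⟩ := by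
  apply lt_or_gt_of_ne
  simp [Fin.ext_iff]

theorem card_inversions_le_length (w : List (Fin (n - 1))) :
    (inversions (w.map simpleTransposition).prod).card ≤ w.length := by
  induction w with
  | nil =>
    simp only [List.map_nil, List.prod_nil, List.length_nil, Nat.le_zero, Finset.card_eq_zero]
    ext ⟨a, b⟩
    simp only [mem_inversions, Equiv.Perm.one_apply, Finset.notMem_empty, iff_false]
    omega
  | cons i w ih =>
    simp only [List.map_cons, List.prod_cons, List.length_cons]
    rcases inv_lt_or_gt i (w.map simpleTransposition).prod with h | h
    · have := card_inversions_mul i _ h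
      omega
    · have := card_inversions_mul_of_gt i _ h
      omega

theorem exists_word (σ : Equiv.Perm (Fin n)) :
    ∃ w : List (Fin (n - 1)), w.length = (inversions σ).card ∧
      (w.map simpleTransposition).prod = σ := by
  induction hk : (inversions σ).card generalizing σ with
  | zero =>
    refine ⟨[], rfl, ?_⟩
    have hmono : StrictMono σ := by
      intro a b hab
      have h1 : (a, b) ∉ inversions σ := by
        rw [Finset.card_eq_zero.mp hk]; simp
      rw [mem_inversions] at h1
      have h2 : (σ a : ℕ) ≠ σ b := fun h => hab.ne (σ.injective (Fin.ext h))
      rw [Fin.lt_def] at hab ⊢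
      omega
    ext a
    exact congrArg Fin.val (DFunLike.congr_fun (Subsingleton.elim (OrderIso.refl (Fin n))
      (hmono.orderIsoOfSurjective σ σ.surjective)) a)
  | succ k ih =>
    by_cases hd : ∃ i : Fin (n - 1), σ⁻¹ ⟨i + 1, by omega⟩ < σ⁻¹ ⟨i, by omega⟩
    · obtain ⟨i, hi⟩ := hd
      have h1 := card_inversions_mul_of_gt i σ hi
      obtain ⟨w, hw, hw'⟩ := ih (simpleTransposition i * σ) (by omega)
      refine ⟨i :: w, by simp [hw], ?_⟩
      rw [List.map_cons, List.prod_cons, hw', ← mul_assoc, simpleTransposition_mul_self, one_mul]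
    · exfalso
      push Not at hd
      have hmono : Monotone (σ⁻¹ : Equiv.Perm (Fin n)) := by
        rcases n with _ | m
        · intro a; exact a.elim0
        · rw [Fin.monotone_iff_le_succ]
          intro i
          exact hd i
      have : inversions σ = ∅ := by
        ext ⟨a, b⟩
        simp only [mem_inversions, Finset.notMem_empty, iff_false, not_and, not_lt]
        intro hab
        by_contra hlt
        have h1 := hmono (Fin.le_def.mpr (le_of_lt (not_le.mp hlt)))
        simp only [Equiv.Perm.coe_inv, Equiv.symm_apply_apply, Fin.le_def] at h1
        omega
      rw [this] at hk
      simp at hk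

theorem permLength_eq (σ : Equiv.Perm (Fin n)) : permLength σ = (inversions σ).card := by
  apply le_antisymm
  · exact Nat.sInf_le (exists_word σ)
  · obtain ⟨w, hw, hσ⟩ := Nat.sInf_mem (s := {k | ∃ w : List (Fin (n - 1)),
      w.length = k ∧ (w.map simpleTransposition).prod = σ}) ⟨_, exists_word σ⟩
    have h := card_inversions_le_length w
    rw [hσ, hw] at h
    exact h

theorem mem_leftDescents_iff (σ : Equiv.Perm (Fin n)) (i : Fin (n - 1)) :
    i ∈ leftDescents σ ↔ σ⁻¹ ⟨i + 1, by omega⟩ < σ⁻¹ ⟨i, by omega⟩ := by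
  simp only [leftDescents, Set.mem_ofPred_eq, permLength_eq]
  rcases inv_lt_or_gt i σ with h | h
  · have := card_inversions_mul i σ h
    exact ⟨fun h' => by omega, fun h' => absurd h (lt_asymm h')⟩
  · have := card_inversions_mul_of_gt i σ h
    exact ⟨fun _ => h, fun _ => by omega⟩

end Length

/-- The condition of Björner and Wachs. The poset `P` on `Fin n` carries labels that are also
compared in their natural order, always through their values in `ℕ`. -/
def IsRegular {n : ℕ} (P : PartialOrder (Fin n)) : Prop :=
  ∀ x y z : Fin n, P.le x z →
    ((x : ℕ) < y ∧ (y : ℕ) < z ∨ (z : ℕ) < y ∧ (y : ℕ) < x) → P.le x y ∨ P.le y z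

/-- A skew partition `λ/μ`: two partitions (as Young diagrams) with `μ` contained in `λ`. -/
@[ext]
structure SkewPartition where
  outer : YoungDiagram
  inner : YoungDiagram
  inner_le : inner ≤ outer

/-- The boxes `(row, column)` of `λ/μ`; rows go downwards, columns to the right, from `0`. -/
def SkewPartition.diagram (S : SkewPartition) : Finset (ℕ × ℕ) :=
  S.outer.cells \ S.inner.cells

/-- No row and no column of the diagram is empty. -/
structure SkewPartition.IsBasic (S : SkewPartition) : Prop where
  row_nonempty : ∀ r < S.outer.colLen 0, ∃ c, (r, c) ∈ S.diagram
  col_nonempty : ∀ c < S.outer.rowLen 0, ∃ r, (r, c) ∈ S.diagram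

/-- Two boxes are adjacent when they share an edge. -/
def SkewPartition.boxGraph (S : SkewPartition) : SimpleGraph S.diagram where
  Adj b b' :=
    (b.1.1 = b'.1.1 ∧ (b.1.2 + 1 = b'.1.2 ∨ b'.1.2 + 1 = b.1.2)) ∨
      (b.1.2 = b'.1.2 ∧ (b.1.1 + 1 = b'.1.1 ∨ b'.1.1 + 1 = b.1.1))
  symm := ⟨fun b b' h => by omega⟩
  loopless := ⟨fun b h => by omega⟩

/-- The connected components of the diagram. -/
abbrev SkewPartition.Component (S : SkewPartition) : Type :=
  S.boxGraph.ConnectedComponent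

/-- The component `C` lies above the component `D`. -/
def SkewPartition.Component.IsAbove {S : SkewPartition} (C D : S.Component) : Prop :=
  ∀ b ∈ C.supp, ∀ b' ∈ D.supp, b.1.1 < b'.1.1

/-- A Schur labeling of some skew shape of size `n`: a bijective filling whose rows decrease from
left to right and whose columns increase from top to bottom. -/
structure SchurLabeling (n : ℕ) where
  shape : SkewPartition
  filling : shape.diagram ≃ Fin n
  row_decreasing : ∀ b b' : shape.diagram,
    b.1.1 = b'.1.1 → b.1.2 < b'.1.2 → (filling b' : ℕ) < filling b
  col_increasing : ∀ b b' : shape.diagram,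
    b.1.2 = b'.1.2 → b.1.1 < b'.1.1 → (filling b : ℕ) < filling b'

/-- The poset of a labeling: `x ≼ y` when the box of `x` is weakly upper-left of the box of `y`. -/
abbrev SchurLabeling.poset {n : ℕ} (τ : SchurLabeling n) : PartialOrder (Fin n) :=
  PartialOrder.lift (fun x => (τ.filling.symm x : ℕ × ℕ))
    (Subtype.val_injective.comp τ.filling.symm.injective)

/-- The least entry in a component. -/
noncomputable def SchurLabeling.minEntry {n : ℕ} (τ : SchurLabeling n)
    (C : τ.shape.Component) : ℕ :=
  sInf {m | ∃ b ∈ C.supp, (τ.filling b : ℕ) = m}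

/-- Schur labeled skew shape posets (all shapes are basic). -/
def IsSchurLabeledSkewShape {n : ℕ} (P : PartialOrder (Fin n)) : Prop :=
  ∃ τ : SchurLabeling n, τ.shape.IsBasic ∧ τ.poset = P

/-- The three conditions that determine the labeling `τ_P` of `P`. -/
structure SchurLabeling.IsCanonicalFor {n : ℕ} (τ : SchurLabeling n)
    (P : PartialOrder (Fin n)) : Prop where
  basic : τ.shape.IsBasic
  poset_eq : τ.poset = P
  min_lt_min : ∀ C D : τ.shape.Component, C.IsAbove D → τ.minEntry C < τ.minEntry D

section Existence

theorem SkewPartition.mem_diagram_of_between (S : SkewPartition) {a b p : ℕ × ℕ}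
    (ha : a ∈ S.diagram) (hb : b ∈ S.diagram) (hap : a ≤ p) (hpb : p ≤ b) : p ∈ S.diagram := by
  simp only [SkewPartition.diagram, Finset.mem_sdiff, YoungDiagram.mem_cells] at *
  exact ⟨S.outer.isLowerSet hpb hb.1, fun h => ha.2 (S.inner.isLowerSet hap h)⟩

theorem SkewPartition.reachable_of_le (S : SkewPartition) (a b : S.diagram) (h : a.1 ≤ b.1) :
    S.boxGraph.Reachable a b := by
  obtain ⟨⟨r, c⟩, hb⟩ := b
  obtain ⟨⟨r', c'⟩, ha⟩ := a
  simp only [Prod.mk_le_mk] at h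
  induction hk : (r - r') + (c - c') generalizing r c with
  | zero =>
    obtain rfl : r = r' := by omega
    obtain rfl : c = c' := by omega
    exact SimpleGraph.Reachable.refl _
  | succ k ih =>
    by_cases hr : r' < r
    · have hm : (r - 1, c) ∈ S.diagram :=
        S.mem_diagram_of_between ha hb (Prod.mk_le_mk.mpr ⟨by omega, h.2⟩)
          (Prod.mk_le_mk.mpr ⟨by omega, le_rfl⟩)
      refine (ih (r - 1) c hm ⟨by omega, h.2⟩ (by omega)).trans (SimpleGraph.Adj.reachable ?_)
      exact Or.inr ⟨rfl, Or.inl (show r - 1 + 1 = r by omega)⟩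
    · have hm : (r, c - 1) ∈ S.diagram :=
        S.mem_diagram_of_between ha hb (Prod.mk_le_mk.mpr ⟨h.1, by omega⟩)
          (Prod.mk_le_mk.mpr ⟨le_rfl, by omega⟩)
      refine (ih r (c - 1) hm ⟨h.1, by omega⟩ (by omega)).trans (SimpleGraph.Adj.reachable ?_)
      exact Or.inl ⟨rfl, Or.inl (show c - 1 + 1 = c by omega)⟩

theorem SkewPartition.le_or_ge_of_adj (S : SkewPartition) {a b : S.diagram}
    (h : S.boxGraph.Adj a b) : a.1 ≤ b.1 ∨ b.1 ≤ a.1 := by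
  simp only [SkewPartition.boxGraph] at h
  simp only [Prod.le_def]
  omega

theorem SkewPartition.eq_of_reachable {α : Type*} (S : SkewPartition) (f : S.diagram → α)
    (hf : ∀ a b : S.diagram, a.1 ≤ b.1 → f a = f b) {a b : S.diagram}
    (h : S.boxGraph.Reachable a b) : f a = f b := by
  obtain ⟨w⟩ := h
  induction w with
  | nil => rfl
  | cons hadj _ ih =>
    refine Eq.trans ?_ ih
    rcases S.le_or_ge_of_adj hadj with h | h
    · exact hf _ _ h
    · exact (hf _ _ h).symm

/-- A finite order-convex set of boxes is the diagram of a skew partition. -/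
def SkewPartition.ofConvex (C : Finset (ℕ × ℕ))
    (hC : ∀ a ∈ C, ∀ b ∈ C, ∀ p, a ≤ p → p ≤ b → p ∈ C) : SkewPartition where
  outer := 
    { cells := C.biUnion fun a => Finset.Iic a
      isLowerSet := by
        intro a b hba ha
        simp only [Finset.coe_biUnion, Set.mem_iUnion, Finset.coe_Iic, Set.mem_Iic,
          SetLike.mem_coe] at ha ⊢
        obtain ⟨x, hx, hax⟩ := ha
        exact ⟨x, hx, hba.trans hax⟩ }
  inner := 
    { cells := (C.biUnion fun a => Finset.Iic a) \ C
      isLowerSet := by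
        intro a b hba ha
        simp only [Finset.coe_sdiff, Set.mem_sdiff, SetLike.mem_coe, Finset.mem_biUnion,
          Finset.mem_Iic] at ha ⊢
        obtain ⟨⟨x, hx, hax⟩, haC⟩ := ha
        exact ⟨⟨x, hx, hba.trans hax⟩, fun hb => haC (hC b hb x hx a hba hax)⟩ }
  inner_le := Finset.sdiff_subset

theorem SkewPartition.diagram_ofConvex (C : Finset (ℕ × ℕ))
    (hC : ∀ a ∈ C, ∀ b ∈ C, ∀ p, a ≤ p → p ≤ b → p ∈ C) :
    (SkewPartition.ofConvex C hC).diagram = C := by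
  ext a
  simp only [SkewPartition.diagram, SkewPartition.ofConvex, Finset.mem_sdiff, Finset.mem_biUnion,
    Finset.mem_Iic, not_and, not_not]
  exact ⟨fun h => h.2 h.1, fun h => ⟨⟨a, h, le_rfl⟩, fun _ => h⟩⟩

theorem SkewPartition.mem_outer_ofConvex (C : Finset (ℕ × ℕ))
    (hC : ∀ a ∈ C, ∀ b ∈ C, ∀ p, a ≤ p → p ≤ b → p ∈ C) (p : ℕ × ℕ) :
    p ∈ (SkewPartition.ofConvex C hC).outer ↔ ∃ a ∈ C, p ≤ a := by
  rw [← YoungDiagram.mem_cells]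
  simp [SkewPartition.ofConvex]

theorem exists_rank {ι α : Type*} [Fintype ι] [LinearOrder α] (f : ι → α) :
    ∃ ρ : ι → ℕ, (∀ b b', ρ b ≤ ρ b' ↔ f b ≤ f b') ∧ ∀ b i, i ≤ ρ b → ∃ b', ρ b' = i := by
  classical
  let A : Finset α := Finset.univ.image f
  have hA : ∀ b, f b ∈ A := fun b => Finset.mem_image_of_mem f (Finset.mem_univ b)
  let e := A.orderIsoOfFin rfl
  refine ⟨fun b => (e.symm ⟨f b, hA b⟩ : ℕ), fun b b' => ?_, fun b i hi => ?_⟩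
  · rw [← Fin.le_def, e.symm.le_iff_le, Subtype.mk_le_mk]
  · have hlt : i < A.card := lt_of_le_of_lt hi (Fin.is_lt _)
    obtain ⟨b', -, hb'⟩ := Finset.mem_image.mp (e ⟨i, hlt⟩).2
    refine ⟨b', ?_⟩
    have h : (⟨f b', hA b'⟩ : A) = e ⟨i, hlt⟩ := Subtype.ext hb'
    simp only [h, OrderIso.symm_apply_apply]

theorem SchurLabeling.minEntry_mem {n : ℕ} (τ : SchurLabeling n) (C : τ.shape.Component) :
    ∃ b ∈ C.supp, (τ.filling b : ℕ) = τ.minEntry C := by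
  obtain ⟨b, hb⟩ := C.nonempty_supp
  exact Nat.sInf_mem (s := {m | ∃ b ∈ C.supp, (τ.filling b : ℕ) = m}) ⟨_, b, hb, rfl⟩

theorem SchurLabeling.minEntry_injective {n : ℕ} (τ : SchurLabeling n) :
    Function.Injective τ.minEntry := by
  intro C D h
  obtain ⟨b, hb, hb'⟩ := τ.minEntry_mem C
  obtain ⟨d, hd, hd'⟩ := τ.minEntry_mem D
  have hbd : b = d := τ.filling.injective (Fin.ext (by rw [hb', hd', h]))
  rw [SimpleGraph.ConnectedComponent.mem_supp_iff] at hb hd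
  rw [← hb, ← hd, hbd]

theorem exists_isCanonicalFor {n : ℕ} {P : PartialOrder (Fin n)}
    (hP : IsSchurLabeledSkewShape P) : ∃ τ : SchurLabeling n, τ.IsCanonicalFor P := by
  classical
  obtain ⟨τ, -, hτ⟩ := hP
  let m : τ.shape.diagram → ℕ := fun b => τ.minEntry (τ.shape.boxGraph.connectedComponentMk b)
  have m_of_le : ∀ a b : τ.shape.diagram, a.1 ≤ b.1 → m a = m b := fun a b h =>
    congrArg τ.minEntry (SimpleGraph.ConnectedComponent.eq.mpr (τ.shape.reachable_of_le a b h))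
  have reach_of_m : ∀ a b : τ.shape.diagram, m a = m b → τ.shape.boxGraph.Reachable a b :=
    fun a b h => SimpleGraph.ConnectedComponent.eq.mp (τ.minEntry_injective h)
  obtain ⟨ρ, hρ, hρ'⟩ := exists_rank fun b : τ.shape.diagram => toLex (m b, b.1.1)
  obtain ⟨κ, hκ, hκ'⟩ := exists_rank fun b : τ.shape.diagram =>
    toLex (OrderDual.toDual (m b), b.1.2)
  simp only [Prod.Lex.toLex_le_toLex, OrderDual.toDual_lt_toDual,
    OrderDual.toDual_inj] at hρ hκ
  let φ : τ.shape.diagram → ℕ × ℕ := fun b => (ρ b, κ b)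
  have hφ : ∀ a b, φ a ≤ φ b ↔ a.1 ≤ b.1 := by
    intro a b
    simp only [φ, Prod.mk_le_mk, hρ, hκ]
    constructor
    · intro h
      rw [Prod.le_def]
      omega
    · intro h
      have := m_of_le a b h
      rw [Prod.le_def] at h
      omega
  have φ_inj : Function.Injective φ := fun a b h =>
    Subtype.ext (le_antisymm ((hφ a b).mp h.le) ((hφ b a).mp h.ge))
  have convex : ∀ a ∈ Finset.univ.image φ, ∀ b ∈ Finset.univ.image φ, ∀ p, a ≤ p → p ≤ b →
      p ∈ Finset.univ.image φ := by
    intro _ ha _ hb p hap hpb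
    obtain ⟨a, -, rfl⟩ := Finset.mem_image.mp ha
    obtain ⟨b, -, rfl⟩ := Finset.mem_image.mp hb
    have hab := m_of_le a b ((hφ a b).mp (hap.trans hpb))
    obtain ⟨x, hx⟩ := hρ' b p.1 hpb.1
    obtain ⟨y, hy⟩ := hκ' b p.2 hpb.2
    have h1 := (hρ a x).mp (hx ▸ hap.1)
    have h2 := (hρ x b).mp (hx ▸ hpb.1)
    have h3 := (hκ a y).mp (hy ▸ hap.2)
    have h4 := (hκ y b).mp (hy ▸ hpb.2)
    have h5 : a.1 ≤ (x.1.1, y.1.2) := Prod.le_def.mpr ⟨by simp only; omega, by simp only; omega⟩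
    have h6 : (x.1.1, y.1.2) ≤ b.1 := Prod.le_def.mpr ⟨by simp only; omega, by simp only; omega⟩
    let z : τ.shape.diagram :=
      ⟨(x.1.1, y.1.2), τ.shape.mem_diagram_of_between a.2 b.2 h5 h6⟩
    have hz : m a = m z := m_of_le a z h5
    refine Finset.mem_image.mpr ⟨z, Finset.mem_univ _, Prod.ext ?_ ?_⟩
    · refine Eq.trans (le_antisymm ?_ ?_) hx
      · exact (hρ z x).mpr (Or.inr ⟨by omega, le_rfl⟩)
      · exact (hρ x z).mpr (Or.inr ⟨by omega, le_rfl⟩)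
    · refine Eq.trans (le_antisymm ?_ ?_) hy
      · exact (hκ z y).mpr (Or.inr ⟨by omega, le_rfl⟩)
      · exact (hκ y z).mpr (Or.inr ⟨by omega, le_rfl⟩)
  let S : SkewPartition := SkewPartition.ofConvex (Finset.univ.image φ) convex
  have hS : S.diagram = Finset.univ.image φ := SkewPartition.diagram_ofConvex _ _
  have mem_S : ∀ b, φ b ∈ S.diagram := fun b =>
    hS ▸ Finset.mem_image_of_mem φ (Finset.mem_univ b)
  let e : τ.shape.diagram ≃ S.diagram := Equiv.ofBijective (fun b => ⟨φ b, mem_S b⟩) <| by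
    refine ⟨fun a b h => φ_inj (congrArg Subtype.val h), fun ⟨p, hp⟩ => ?_⟩
    rw [hS] at hp
    obtain ⟨b, -, rfl⟩ := Finset.mem_image.mp hp
    exact ⟨b, rfl⟩
  have he : ∀ b, (e b).1 = φ b := fun b => rfl
  have hle : ∀ a b, (e a).1 ≤ (e b).1 ↔ a.1 ≤ b.1 := hφ
  let τ' : SchurLabeling n :=
    { shape := S
      filling := e.symm.trans τ.filling
      row_decreasing := by
        intro b b' h1 h2
        obtain ⟨a, rfl⟩ := e.surjective b
        obtain ⟨a', rfl⟩ := e.surjective b'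
        have h3 : ρ a = ρ a' := h1
        have h4 : κ a < κ a' := h2
        have h5 := (hρ a a').mp h3.le
        have h6 := (hρ a' a).mp h3.ge
        have h7 := (hκ a' a).not.mp (not_le.mpr h4)
        simp only [Equiv.trans_apply, Equiv.symm_apply_apply]
        exact τ.row_decreasing a a' (by omega) (by omega)
      col_increasing := by
        intro b b' h1 h2
        obtain ⟨a, rfl⟩ := e.surjective b
        obtain ⟨a', rfl⟩ := e.surjective b'
        have h3 : κ a = κ a' := h1
        have h4 : ρ a < ρ a' := h2
        have h5 := (hκ a a').mp h3.le
        have h6 := (hκ a' a).mp h3.ge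
        have h7 := (hρ a' a).not.mp (not_le.mpr h4)
        simp only [Equiv.trans_apply, Equiv.symm_apply_apply]
        exact τ.col_increasing a a' (by omega) (by omega) }
  have fill : ∀ a, τ'.filling (e a) = τ.filling a := fun a => by
    simp only [τ', Equiv.trans_apply, Equiv.symm_apply_apply]
  have reach : ∀ a b, S.boxGraph.Reachable (e a) (e b) ↔ τ.shape.boxGraph.Reachable a b := by
    intro a b
    constructor
    · intro h
      have h1 := S.eq_of_reachable
        (fun x => τ.shape.boxGraph.connectedComponentMk (e.symm x)) (fun x y hxy => by
          refine SimpleGraph.ConnectedComponent.eq.mpr (τ.shape.reachable_of_le _ _ ?_)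
          rw [← hle]
          simpa only [Equiv.apply_symm_apply] using hxy) h
      simpa only [Equiv.symm_apply_apply, SimpleGraph.ConnectedComponent.eq] using h1
    · intro h
      have h1 := τ.shape.eq_of_reachable
        (fun x => S.boxGraph.connectedComponentMk (e x)) (fun x y hxy =>
          SimpleGraph.ConnectedComponent.eq.mpr (S.reachable_of_le _ _ ((hle x y).mpr hxy))) h
      simpa only [SimpleGraph.ConnectedComponent.eq] using h1
  have min_eq : ∀ a, τ'.minEntry (S.boxGraph.connectedComponentMk (e a)) = m a := by
    intro a
    refine congrArg sInf (Set.ext fun k => ⟨?_, ?_⟩)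
    · rintro ⟨b, hb, hk⟩
      obtain ⟨b, rfl⟩ := e.surjective b
      rw [SimpleGraph.ConnectedComponent.mem_supp_iff, SimpleGraph.ConnectedComponent.eq,
        reach] at hb
      exact ⟨b, SimpleGraph.ConnectedComponent.eq.mpr hb, by rw [← hk, fill]⟩
    · rintro ⟨b, hb, hk⟩
      rw [SimpleGraph.ConnectedComponent.mem_supp_iff, SimpleGraph.ConnectedComponent.eq,
        ← reach] at hb
      exact ⟨e b, SimpleGraph.ConnectedComponent.eq.mpr hb, by rw [← hk, fill]⟩
  refine ⟨τ', ⟨⟨fun r hr => ?_, fun c hc => ?_⟩, ?_, ?_⟩⟩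
  · rw [← YoungDiagram.mem_iff_lt_colLen] at hr
    obtain ⟨a, ha, hra⟩ := (SkewPartition.mem_outer_ofConvex _ convex _).mp hr
    obtain ⟨a, -, rfl⟩ := Finset.mem_image.mp ha
    obtain ⟨b, hb⟩ := hρ' a r hra.1
    exact ⟨κ b, hb ▸ mem_S b⟩
  · rw [← YoungDiagram.mem_iff_lt_rowLen] at hc
    obtain ⟨a, ha, hca⟩ := (SkewPartition.mem_outer_ofConvex _ convex _).mp hc
    obtain ⟨a, -, rfl⟩ := Finset.mem_image.mp ha
    obtain ⟨b, hb⟩ := hκ' a c hca.2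
    exact ⟨ρ b, hb ▸ mem_S b⟩
  · rw [← hτ]
    refine PartialOrder.ext fun x y => ?_
    exact hle (τ.filling.symm x) (τ.filling.symm y)
  · intro C D hCD
    obtain ⟨a, ha⟩ := C.nonempty_supp
    obtain ⟨b, hb⟩ := D.nonempty_supp
    obtain ⟨a, rfl⟩ := e.surjective a
    obtain ⟨b, rfl⟩ := e.surjective b
    have hlt : ρ a < ρ b := hCD _ ha _ hb
    rw [SimpleGraph.ConnectedComponent.mem_supp_iff] at ha hb
    rw [← ha, ← hb, min_eq, min_eq]
    have h1 := (hρ b a).not.mp (not_le.mpr hlt)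
    have h2 : m a ≠ m b := by
      intro h
      have h3 : C = D := by
        rw [← ha, ← hb]
        exact SimpleGraph.ConnectedComponent.eq.mpr ((reach a b).mpr (reach_of_m a b h))
      subst h3
      exact lt_irrefl _ (hCD (e a) ha (e a) ha)
    omega

theorem SkewPartition.mem_outer_iff {S : SkewPartition} (hS : S.IsBasic) (p : ℕ × ℕ) :
    p ∈ S.outer ↔ ∃ d ∈ S.diagram, p ≤ d := by
  constructor
  · intro hp
    by_cases hd : p ∈ S.diagram
    · exact ⟨p, hd, le_rfl⟩
    have hin : p ∈ S.inner := by
      by_contra h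
      exact hd (Finset.mem_sdiff.mpr ⟨hp, h⟩)
    obtain ⟨c, hc⟩ := hS.row_nonempty p.1
      (YoungDiagram.mem_iff_lt_colLen.mp (S.outer.up_left_mem le_rfl (Nat.zero_le p.2) hp))
    refine ⟨_, hc, Prod.le_def.mpr ⟨le_rfl, ?_⟩⟩
    by_contra h
    exact (Finset.mem_sdiff.mp hc).2 (S.inner.up_left_mem le_rfl (not_le.mp h).le hin)
  · rintro ⟨d, hd, hpd⟩
    exact S.outer.isLowerSet hpd (Finset.mem_sdiff.mp hd).1

theorem SkewPartition.mem_inner_iff (S : SkewPartition) (p : ℕ × ℕ) :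
    p ∈ S.inner ↔ p ∈ S.outer ∧ p ∉ S.diagram := by
  simp only [SkewPartition.diagram, Finset.mem_sdiff, YoungDiagram.mem_cells, not_and, not_not]
  exact ⟨fun h => ⟨S.inner_le h, fun _ => h⟩, fun h => h.2 h.1⟩

theorem SkewPartition.eq_of_diagram_eq {S T : SkewPartition} (hS : S.IsBasic) (hT : T.IsBasic)
    (h : S.diagram = T.diagram) : S = T := by
  have ho : S.outer = T.outer := SetLike.ext fun p => by
    rw [mem_outer_iff hS, mem_outer_iff hT, h]
  refine SkewPartition.ext ho (SetLike.ext fun p => ?_)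
  rw [mem_inner_iff, mem_inner_iff, ho, h]

theorem SkewPartition.row_ne (S : SkewPartition) {a b : S.diagram}
    (h : ¬ S.boxGraph.Reachable a b) : a.1.1 ≠ b.1.1 := by
  intro hab
  rcases le_total a.1.2 b.1.2 with h1 | h1
  · exact h (S.reachable_of_le a b (Prod.le_def.mpr ⟨hab.le, h1⟩))
  · exact h (S.reachable_of_le b a (Prod.le_def.mpr ⟨hab.ge, h1⟩)).symm

theorem SkewPartition.row_lt_iff_col_lt (S : SkewPartition) {a b : S.diagram}
    (h : ¬ S.boxGraph.Reachable a b) : a.1.1 < b.1.1 ↔ b.1.2 < a.1.2 := by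
  have h1 : ¬ a.1 ≤ b.1 := fun h' => h (S.reachable_of_le a b h')
  have h2 : ¬ b.1 ≤ a.1 := fun h' => h (S.reachable_of_le b a h').symm
  rw [Prod.le_def] at h1 h2
  omega

theorem SkewPartition.row_lt_congr (S : SkewPartition) {a a' b : S.diagram}
    (haa : S.boxGraph.Reachable a a') (hab : ¬ S.boxGraph.Reachable a b) :
    a.1.1 < b.1.1 ↔ a'.1.1 < b.1.1 := by
  obtain ⟨w⟩ := haa
  induction w with
  | nil => rfl
  | @cons u v _ hadj _ ih =>
    have hv : ¬ S.boxGraph.Reachable v b := fun h => hab (hadj.reachable.trans h)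
    rw [← ih hv]
    have h1 := S.row_ne hab
    have h2 := S.row_ne hv
    simp only [SkewPartition.boxGraph] at hadj
    omega

theorem SchurLabeling.IsCanonicalFor.row_lt_iff {n : ℕ} {τ : SchurLabeling n}
    {P : PartialOrder (Fin n)} (h : τ.IsCanonicalFor P) {a b : τ.shape.diagram}
    (hab : ¬ τ.shape.boxGraph.Reachable a b) :
    a.1.1 < b.1.1 ↔ τ.minEntry (τ.shape.boxGraph.connectedComponentMk a) <
      τ.minEntry (τ.shape.boxGraph.connectedComponentMk b) := by
  have key : ∀ a b : τ.shape.diagram, ¬ τ.shape.boxGraph.Reachable a b → a.1.1 < b.1.1 →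
      τ.minEntry (τ.shape.boxGraph.connectedComponentMk a) <
        τ.minEntry (τ.shape.boxGraph.connectedComponentMk b) := by
    intro a b hab hlt
    refine h.min_lt_min _ _ fun a' ha' b' hb' => ?_
    rw [SimpleGraph.ConnectedComponent.mem_supp_iff, SimpleGraph.ConnectedComponent.eq] at ha' hb'
    have h1 := (τ.shape.row_lt_congr ha'.symm hab).mp hlt
    have h2 : ¬ τ.shape.boxGraph.Reachable b a' := fun h => hab (ha'.symm.trans h.symm)
    have h3 := τ.shape.row_lt_congr hb'.symm h2
    have h4 : ¬ τ.shape.boxGraph.Reachable b' a' := fun h => h2 (hb'.symm.trans h)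
    have h5 := τ.shape.row_ne h4
    omega
  constructor
  · exact key a b hab
  · intro hlt
    have h1 := τ.shape.row_ne hab
    by_contra h2
    have h3 := key b a (fun h => hab h.symm) (by omega)
    omega

theorem eq_of_rank {ι : Type*} (f g : ι → ℕ) (h : ∀ x y, f x < f y ↔ g x < g y)
    (hf : ∀ x, ∀ k < f x, ∃ z, f z = k) (hg : ∀ x, ∀ k < g x, ∃ z, g z = k) (x : ι) :
    f x = g x := by
  induction hk : f x using Nat.strong_induction_on generalizing x with
  | _ k ih =>
    subst hk
    apply le_antisymm
    · by_contra hlt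
      obtain ⟨z, hz⟩ := hf x (g x) (not_le.mp hlt)
      have h1 := ih (f z) (by omega) z rfl
      have h2 := (h z x).mp (by omega)
      omega
    · by_contra hlt
      obtain ⟨z, hz⟩ := hg x (f x) (not_le.mp hlt)
      have h1 := (h z x).mpr (by omega)
      have h2 := ih (f z) h1 z rfl
      omega

theorem SchurLabeling.step {n : ℕ} {τ σ : SchurLabeling n} (hp : τ.poset = σ.poset) {x y : Fin n}
    (h : τ.shape.boxGraph.Adj (τ.filling.symm x) (τ.filling.symm y)) :
    ((τ.filling.symm x).1.1 : ℤ) - (σ.filling.symm x).1.1 =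
        (τ.filling.symm y).1.1 - (σ.filling.symm y).1.1 ∧
      ((τ.filling.symm x).1.2 : ℤ) - (σ.filling.symm x).1.2 =
        (τ.filling.symm y).1.2 - (σ.filling.symm y).1.2 := by
  wlog hxy : (τ.filling.symm x).1 ≤ (τ.filling.symm y).1 generalizing x y
  · have h1 := this h.symm ((τ.shape.le_or_ge_of_adj h).resolve_left hxy)
    exact ⟨h1.1.symm, h1.2.symm⟩
  have hle : ∀ u v : Fin n, (τ.filling.symm u).1 ≤ (τ.filling.symm v).1 ↔
      (σ.filling.symm u).1 ≤ (σ.filling.symm v).1 := fun u v => by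
    have : τ.poset.le u v ↔ σ.poset.le u v := by rw [hp]
    exact this
  have hσ := (hle x y).mp hxy
  have between : ∀ p, (σ.filling.symm x).1 ≤ p → p ≤ (σ.filling.symm y).1 →
      p = (σ.filling.symm x).1 ∨ p = (σ.filling.symm y).1 := by
    intro p h1 h2
    let d : σ.shape.diagram := ⟨p, σ.shape.mem_diagram_of_between
      (σ.filling.symm x).2 (σ.filling.symm y).2 h1 h2⟩
    have hd : (σ.filling.symm (σ.filling d)).1 = p := by rw [Equiv.symm_apply_apply]
    have h3 := (hle x (σ.filling d)).mpr (by rw [hd]; exact h1)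
    have h4 := (hle (σ.filling d) y).mpr (by rw [hd]; exact h2)
    have h5 : (τ.filling.symm (σ.filling d)).1 = (τ.filling.symm x).1 ∨
        (τ.filling.symm (σ.filling d)).1 = (τ.filling.symm y).1 := by
      simp only [SkewPartition.boxGraph] at h
      rw [Prod.le_def] at h3 h4
      simp only [Prod.ext_iff]
      omega
    rcases h5 with h5 | h5
    · left
      rw [← hd, τ.filling.symm.injective (Subtype.ext h5)]
    · right
      rw [← hd, τ.filling.symm.injective (Subtype.ext h5)]
  have hne : (τ.filling.symm x).1 ≠ (τ.filling.symm y).1 := fun he => by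
    simp only [SkewPartition.boxGraph] at h
    rw [Prod.ext_iff] at he
    omega
  have hne' : (σ.filling.symm x).1 ≠ (σ.filling.symm y).1 := fun he =>
    hne (congrArg (fun z => (τ.filling.symm z).1) (σ.filling.symm.injective (Subtype.ext he)))
  have τrow := τ.row_decreasing (τ.filling.symm x) (τ.filling.symm y)
  have τcol := τ.col_increasing (τ.filling.symm x) (τ.filling.symm y)
  have σrow := σ.row_decreasing (σ.filling.symm x) (σ.filling.symm y)
  have σcol := σ.col_increasing (σ.filling.symm x) (σ.filling.symm y)
  simp only [Equiv.apply_symm_apply] at τrow τcol σrow σcol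
  simp only [SkewPartition.boxGraph] at h
  have b1 := between ((σ.filling.symm x).1.1 + 1, (σ.filling.symm x).1.2)
  have b2 := between ((σ.filling.symm x).1.1, (σ.filling.symm x).1.2 + 1)
  simp only [Prod.le_def, Prod.ext_iff, ne_eq] at *
  omega

theorem SchurLabeling.IsCanonicalFor.coord_eq {n : ℕ} {τ σ : SchurLabeling n}
    {P : PartialOrder (Fin n)} (hτ : τ.IsCanonicalFor P) (hσ : σ.IsCanonicalFor P) (x : Fin n) :
    (τ.filling.symm x).1 = (σ.filling.symm x).1 := by
  have hp : τ.poset = σ.poset := hτ.poset_eq.trans hσ.poset_eq.symm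
  have transfer : ∀ {τ σ : SchurLabeling n}, τ.poset = σ.poset → ∀ x y,
      τ.shape.boxGraph.Reachable (τ.filling.symm x) (τ.filling.symm y) →
      σ.shape.boxGraph.Reachable (σ.filling.symm x) (σ.filling.symm y) := by
    intro τ σ hp x y h
    have h1 := τ.shape.eq_of_reachable
      (fun b => σ.shape.boxGraph.connectedComponentMk (σ.filling.symm (τ.filling b)))
      (fun a b hab => by
        refine SimpleGraph.ConnectedComponent.eq.mpr (σ.shape.reachable_of_le _ _ ?_)
        have h2 : τ.poset.le (τ.filling a) (τ.filling b) := by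
          change (τ.filling.symm (τ.filling a)).1 ≤ (τ.filling.symm (τ.filling b)).1
          simpa only [Equiv.symm_apply_apply] using hab
        rw [hp] at h2
        exact h2) h
    simpa only [Equiv.apply_symm_apply, SimpleGraph.ConnectedComponent.eq] using h1
  have hreach : ∀ x y, τ.shape.boxGraph.Reachable (τ.filling.symm x) (τ.filling.symm y) ↔
      σ.shape.boxGraph.Reachable (σ.filling.symm x) (σ.filling.symm y) := fun x y =>
    ⟨transfer hp x y, transfer hp.symm x y⟩
  have hmin : ∀ x, τ.minEntry (τ.shape.boxGraph.connectedComponentMk (τ.filling.symm x)) =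
      σ.minEntry (σ.shape.boxGraph.connectedComponentMk (σ.filling.symm x)) := by
    intro x
    refine congrArg sInf (Set.ext fun k => ⟨?_, ?_⟩)
    · rintro ⟨b, hb, hk⟩
      obtain ⟨y, rfl⟩ := τ.filling.symm.surjective b
      rw [SimpleGraph.ConnectedComponent.mem_supp_iff, SimpleGraph.ConnectedComponent.eq,
        hreach] at hb
      exact ⟨σ.filling.symm y, SimpleGraph.ConnectedComponent.eq.mpr hb, by simpa using hk⟩
    · rintro ⟨b, hb, hk⟩
      obtain ⟨y, rfl⟩ := σ.filling.symm.surjective b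
      rw [SimpleGraph.ConnectedComponent.mem_supp_iff, SimpleGraph.ConnectedComponent.eq,
        ← hreach] at hb
      exact ⟨τ.filling.symm y, SimpleGraph.ConnectedComponent.eq.mpr hb, by simpa using hk⟩
  have diff : ∀ x y, τ.shape.boxGraph.Reachable (τ.filling.symm x) (τ.filling.symm y) →
      ((τ.filling.symm x).1.1 : ℤ) - (σ.filling.symm x).1.1 =
        (τ.filling.symm y).1.1 - (σ.filling.symm y).1.1 ∧
      ((τ.filling.symm x).1.2 : ℤ) - (σ.filling.symm x).1.2 =
        (τ.filling.symm y).1.2 - (σ.filling.symm y).1.2 := by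
    intro x y h
    obtain ⟨w⟩ := h
    generalize ha : τ.filling.symm x = a at w
    generalize hb : τ.filling.symm y = b at w
    induction w generalizing x with
    | nil =>
      obtain rfl : x = y := τ.filling.symm.injective (ha.trans hb.symm)
      exact ⟨rfl, rfl⟩
    | @cons u v _ hadj _ ih =>
      obtain ⟨z, rfl⟩ := τ.filling.symm.surjective v
      subst ha
      have h1 := SchurLabeling.step hp hadj
      have h2 := ih z rfl hb
      exact ⟨h1.1.trans h2.1, h1.2.trans h2.2⟩
  have rows : ∀ (τ : SchurLabeling n), τ.shape.IsBasic → ∀ x, ∀ k < (τ.filling.symm x).1.1,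
      ∃ z, (τ.filling.symm z).1.1 = k := by
    intro τ hb x k hk
    obtain ⟨c, hc⟩ := hb.row_nonempty k (YoungDiagram.mem_iff_lt_colLen.mp
      (τ.shape.outer.up_left_mem hk.le (Nat.zero_le _)
        (Finset.mem_sdiff.mp (τ.filling.symm x).2).1))
    exact ⟨τ.filling ⟨_, hc⟩, by simp⟩
  have cols : ∀ (τ : SchurLabeling n), τ.shape.IsBasic → ∀ x, ∀ k < (τ.filling.symm x).1.2,
      ∃ z, (τ.filling.symm z).1.2 = k := by
    intro τ hb x k hk
    obtain ⟨r, hr⟩ := hb.col_nonempty k (YoungDiagram.mem_iff_lt_rowLen.mp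
      (τ.shape.outer.up_left_mem (Nat.zero_le _) hk.le
        (Finset.mem_sdiff.mp (τ.filling.symm x).2).1))
    exact ⟨τ.filling ⟨_, hr⟩, by simp⟩
  refine Prod.ext ?_ ?_
  · refine eq_of_rank (fun x => (τ.filling.symm x).1.1) (fun x => (σ.filling.symm x).1.1)
      (fun x y => ?_) (rows τ hτ.basic) (rows σ hσ.basic) x
    by_cases h : τ.shape.boxGraph.Reachable (τ.filling.symm x) (τ.filling.symm y)
    · have := diff x y h
      omega
    · rw [hτ.row_lt_iff h, hσ.row_lt_iff (fun h' => h ((hreach x y).mpr h')), hmin, hmin]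
  · refine eq_of_rank (fun x => (τ.filling.symm x).1.2) (fun x => (σ.filling.symm x).1.2)
      (fun x y => ?_) (cols τ hτ.basic) (cols σ hσ.basic) x
    by_cases h : τ.shape.boxGraph.Reachable (τ.filling.symm x) (τ.filling.symm y)
    · have := diff x y h
      omega
    · have h1 : ¬ τ.shape.boxGraph.Reachable (τ.filling.symm y) (τ.filling.symm x) :=
        fun h' => h h'.symm
      have h2 : ¬ σ.shape.boxGraph.Reachable (σ.filling.symm y) (σ.filling.symm x) :=
        fun h' => h1 ((hreach y x).mpr h')
      rw [← τ.shape.row_lt_iff_col_lt h1, ← σ.shape.row_lt_iff_col_lt h2, hτ.row_lt_iff h1,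
        hσ.row_lt_iff h2, hmin, hmin]

theorem existsUnique_isCanonicalFor {n : ℕ} {P : PartialOrder (Fin n)}
    (hP : IsSchurLabeledSkewShape P) : ∃! τ : SchurLabeling n, τ.IsCanonicalFor P := by
  obtain ⟨τ, hτ⟩ := exists_isCanonicalFor hP
  refine ⟨τ, hτ, fun σ hσ => ?_⟩
  have hc := fun x => hσ.coord_eq hτ x
  have hd : σ.shape.diagram = τ.shape.diagram := by
    ext p
    constructor
    · intro hp
      have h1 := hc (σ.filling ⟨p, hp⟩)
      rw [Equiv.symm_apply_apply] at h1
      have h2 := (τ.filling.symm (σ.filling ⟨p, hp⟩)).2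
      rwa [← h1] at h2
    · intro hp
      have h1 := hc (τ.filling ⟨p, hp⟩)
      rw [Equiv.symm_apply_apply] at h1
      have h2 := (σ.filling.symm (τ.filling ⟨p, hp⟩)).2
      rwa [h1] at h2
  have hs := SkewPartition.eq_of_diagram_eq hσ.basic hτ.basic hd
  obtain ⟨S, f, hf1, hf2⟩ := σ
  obtain ⟨T, g, hg1, hg2⟩ := τ
  obtain rfl : S = T := hs
  have hfg : f = g := by
    rw [← Equiv.symm_bijective.injective.eq_iff]
    exact Equiv.ext fun x => Subtype.ext (hc x)
  subst hfg
  rfl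

end Existence

/-- The labeling `τ_P`: the unique Schur labeling that is canonical for `P`. -/
noncomputable def schurLabelingOf {n : ℕ} (P : PartialOrder (Fin n))
    (hP : IsSchurLabeledSkewShape P) : SchurLabeling n :=
  (existsUnique_isCanonicalFor hP).choose

theorem schurLabelingOf_isCanonicalFor {n : ℕ} (P : PartialOrder (Fin n))
    (hP : IsSchurLabeledSkewShape P) : (schurLabelingOf P hP).IsCanonicalFor P :=
  (existsUnique_isCanonicalFor hP).choose_spec.1

/-- The defining relations of the 0-Hecke algebra. -/
inductive HeckeRel (n : ℕ) :
    FreeAlgebra ℂ (Fin (n - 1)) → FreeAlgebra ℂ (Fin (n - 1)) → Prop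
  | idem (i : Fin (n - 1)) :
      HeckeRel n (FreeAlgebra.ι ℂ i * FreeAlgebra.ι ℂ i) (FreeAlgebra.ι ℂ i)
  | braid (i j : Fin (n - 1)) (h : (j : ℕ) = i + 1) :
      HeckeRel n (FreeAlgebra.ι ℂ i * FreeAlgebra.ι ℂ j * FreeAlgebra.ι ℂ i)
        (FreeAlgebra.ι ℂ j * FreeAlgebra.ι ℂ i * FreeAlgebra.ι ℂ j)
  | comm (i j : Fin (n - 1)) (h : (i : ℕ) + 2 ≤ j) :
      HeckeRel n (FreeAlgebra.ι ℂ i * FreeAlgebra.ι ℂ j)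
        (FreeAlgebra.ι ℂ j * FreeAlgebra.ι ℂ i)

/-- The 0-Hecke algebra `H_n(0)` over `ℂ`: generators `π_i`, one for each simple transposition,
and the relations `π_i² = π_i`, the braid relations and the commutation relations. -/
abbrev ZeroHecke (n : ℕ) : Type := RingQuot (HeckeRel n)

/-- The generator `π_i`. -/
noncomputable def ZeroHecke.gen {n : ℕ} (i : Fin (n - 1)) : ZeroHecke n :=
  RingQuot.mkAlgHom ℂ (HeckeRel n) (FreeAlgebra.ι ℂ i)

/-- `Σ_L(P)`, the linear extensions of `P` as permutations. -/
def linearExtensions {n : ℕ} (P : PartialOrder (Fin n)) : Set (Equiv.Perm (Fin n)) :=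
  {σ | ∀ i j : Fin n, P.le i j → (σ i : ℕ) ≤ σ j}

open Classical in
/-- The operator by which `π_i` acts on the span of `Σ_L(P)`: a basis element `γ` is fixed when
`i` is a left descent of `γ`, and otherwise goes to `s_i γ` if that lies in `Σ_L(P)`, else to `0`. -/
noncomputable def heckeOperator {n : ℕ} (P : PartialOrder (Fin n)) (i : Fin (n - 1)) :
    Module.End ℂ (linearExtensions P →₀ ℂ) :=
  Finsupp.linearCombination ℂ fun γ : linearExtensions P =>
    if i ∈ leftDescents γ.1 then Finsupp.single γ (1 : ℂ)
    else if h : simpleTransposition i * γ.1 ∈ linearExtensions P then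
      Finsupp.single ⟨simpleTransposition i * γ.1, h⟩ (1 : ℂ)
    else 0

section Action

variable {n : ℕ} (P : PartialOrder (Fin n))

open Classical in
/-- The basis element `γ`, or `0` if `γ` is not a linear extension. -/
noncomputable def basisVec (γ : Equiv.Perm (Fin n)) : linearExtensions P →₀ ℂ :=
  if h : γ ∈ linearExtensions P then Finsupp.single ⟨γ, h⟩ 1 else 0

theorem simpleTransposition_mul_inv_apply (i : Fin (n - 1)) (γ : Equiv.Perm (Fin n)) (x : Fin n) :
    (simpleTransposition i * γ)⁻¹ x = γ⁻¹ (simpleTransposition i x) := by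
  rw [mul_inv_rev, Equiv.Perm.mul_apply]
  simp [simpleTransposition]

theorem simpleTransposition_mul_mem {i : Fin (n - 1)} {p q : Fin n} (hp : (p : ℕ) = i)
    (hq : (q : ℕ) = i + 1) {γ : Equiv.Perm (Fin n)} (hγ : γ ∈ linearExtensions P) :
    simpleTransposition i * γ ∈ linearExtensions P ↔ ¬ P.le (γ⁻¹ p) (γ⁻¹ q) := by
  constructor
  · intro h hle
    have := h _ _ hle
    simp only [Equiv.Perm.mul_apply, Equiv.Perm.coe_inv, Equiv.apply_symm_apply,
      simpleTransposition_apply_val] at this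
    split_ifs at this <;> omega
  · intro h x y hxy
    have h1 := hγ x y hxy
    have h2 : ¬ ((γ x : ℕ) = i ∧ (γ y : ℕ) = i + 1) := by
      rintro ⟨hx, hy⟩
      apply h
      have hx' : γ⁻¹ p = x := by
        rw [Equiv.Perm.inv_eq_iff_eq]; exact Fin.ext (by omega)
      have hy' : γ⁻¹ q = y := by
        rw [Equiv.Perm.inv_eq_iff_eq]; exact Fin.ext (by omega)
      rwa [hx', hy']
    simp only [Equiv.Perm.mul_apply, simpleTransposition_apply_val]
    split_ifs <;> omega

open Classical in
theorem heckeOperator_basisVec {i : Fin (n - 1)} {p q : Fin n} (hp : (p : ℕ) = i)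
    (hq : (q : ℕ) = i + 1) {γ : Equiv.Perm (Fin n)} (hγ : γ ∈ linearExtensions P) :
    heckeOperator P i (basisVec P γ) =
      if (γ⁻¹ q : ℕ) < γ⁻¹ p then basisVec P γ
      else if P.le (γ⁻¹ p) (γ⁻¹ q) then 0 else basisVec P (simpleTransposition i * γ) := by
  have hd : i ∈ leftDescents γ ↔ (γ⁻¹ q : ℕ) < γ⁻¹ p := by
    rw [mem_leftDescents_iff, Fin.lt_def]
    have h1 : (⟨i, by omega⟩ : Fin n) = p := Fin.ext hp.symm
    have h2 : (⟨i + 1, by omega⟩ : Fin n) = q := Fin.ext hq.symm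
    rw [h1, h2]
  have hm := simpleTransposition_mul_mem P hp hq hγ
  rw [basisVec, dif_pos hγ, heckeOperator, Finsupp.linearCombination_single, one_smul]
  simp only [hd, basisVec]
  by_cases h1 : (γ⁻¹ q : ℕ) < γ⁻¹ p
  · rw [if_pos h1, if_pos h1]
  · rw [if_neg h1, if_neg h1]
    by_cases h2 : P.le (γ⁻¹ p) (γ⁻¹ q)
    · rw [dif_neg (by rw [hm]; exact not_not.mpr h2), if_pos h2]
    · rw [if_neg h2]

theorem end_ext {f g : Module.End ℂ (linearExtensions P →₀ ℂ)}
    (h : ∀ γ ∈ linearExtensions P, f (basisVec P γ) = g (basisVec P γ)) : f = g := by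
  refine Finsupp.lhom_ext' fun γ => LinearMap.ext_ring ?_
  have := h γ.1 γ.2
  rw [basisVec, dif_pos γ.2] at this
  exact this

theorem heckeOperator_idem (i : Fin (n - 1)) :
    heckeOperator P i * heckeOperator P i = heckeOperator P i := by
  refine end_ext P fun γ hγ => ?_
  obtain ⟨p, hp⟩ : ∃ p : Fin n, (p : ℕ) = i := ⟨⟨i, by omega⟩, rfl⟩
  obtain ⟨q, hq⟩ : ∃ q : Fin n, (q : ℕ) = i + 1 := ⟨⟨i + 1, by omega⟩, rfl⟩
  have hop := fun {γ : Equiv.Perm (Fin n)} hγ => heckeOperator_basisVec P hp hq (γ := γ) hγ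
  have hm := fun {γ : Equiv.Perm (Fin n)} hγ => simpleTransposition_mul_mem P hp hq (γ := γ) hγ
  have sp : simpleTransposition i p = q := Fin.ext (by
    rw [simpleTransposition_apply_val]; simp [hp, hq])
  have sq : simpleTransposition i q = p := Fin.ext (by
    rw [simpleTransposition_apply_val]; simp [hp, hq])
  have hne : (γ⁻¹ q : ℕ) ≠ γ⁻¹ p := fun h => by
    have := γ⁻¹.injective (Fin.ext h)
    omega
  rw [Module.End.mul_apply, hop hγ]
  by_cases h1 : (γ⁻¹ q : ℕ) < γ⁻¹ p
  · rw [if_pos h1, hop hγ, if_pos h1]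
  have h3 : (γ⁻¹ p : ℕ) < γ⁻¹ q := by omega
  rw [if_neg h1]
  by_cases h2 : P.le (γ⁻¹ p) (γ⁻¹ q)
  · rw [if_pos h2, map_zero]
  · rw [if_neg h2, hop ((hm hγ).mpr h2), simpleTransposition_mul_inv_apply,
      simpleTransposition_mul_inv_apply, sp, sq, if_pos h3]

theorem heckeOperator_comm (i j : Fin (n - 1)) (hij : (i : ℕ) + 2 ≤ j) :
    heckeOperator P i * heckeOperator P j = heckeOperator P j * heckeOperator P i := by
  refine end_ext P fun γ hγ => ?_
  obtain ⟨p, hp⟩ : ∃ p : Fin n, (p : ℕ) = i := ⟨⟨i, by omega⟩, rfl⟩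
  obtain ⟨q, hq⟩ : ∃ q : Fin n, (q : ℕ) = i + 1 := ⟨⟨i + 1, by omega⟩, rfl⟩
  obtain ⟨r, hr⟩ : ∃ r : Fin n, (r : ℕ) = j := ⟨⟨j, by omega⟩, rfl⟩
  obtain ⟨t, ht⟩ : ∃ t : Fin n, (t : ℕ) = j + 1 := ⟨⟨j + 1, by omega⟩, rfl⟩
  have hop := fun {γ : Equiv.Perm (Fin n)} hγ => heckeOperator_basisVec P hp hq (γ := γ) hγ
  have hm := fun {γ : Equiv.Perm (Fin n)} hγ => simpleTransposition_mul_mem P hp hq (γ := γ) hγ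
  have hop' := fun {γ : Equiv.Perm (Fin n)} hγ => heckeOperator_basisVec P hr ht (γ := γ) hγ
  have hm' := fun {γ : Equiv.Perm (Fin n)} hγ => simpleTransposition_mul_mem P hr ht (γ := γ) hγ
  have e1 : simpleTransposition i r = r := Fin.ext (by
    rw [simpleTransposition_apply_val]; split_ifs <;> omega)
  have e2 : simpleTransposition i t = t := Fin.ext (by
    rw [simpleTransposition_apply_val]; split_ifs <;> omega)
  have e3 : simpleTransposition j p = p := Fin.ext (by
    rw [simpleTransposition_apply_val]; split_ifs <;> omega)
  have e4 : simpleTransposition j q = q := Fin.ext (by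
    rw [simpleTransposition_apply_val]; split_ifs <;> omega)
  have hc : simpleTransposition i * (simpleTransposition j * γ) =
      simpleTransposition j * (simpleTransposition i * γ) := by
    ext x
    simp only [Equiv.Perm.mul_apply, simpleTransposition_apply_val]
    split_ifs <;> omega
  have inv := fun k (δ : Equiv.Perm (Fin n)) (x : Fin n) => simpleTransposition_mul_inv_apply k δ x
  rw [Module.End.mul_apply, Module.End.mul_apply, hop hγ, hop' hγ]
  by_cases h1 : (γ⁻¹ q : ℕ) < γ⁻¹ p <;> by_cases h2 : P.le (γ⁻¹ p) (γ⁻¹ q) <;>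
  by_cases h3 : (γ⁻¹ t : ℕ) < γ⁻¹ r <;> by_cases h4 : P.le (γ⁻¹ r) (γ⁻¹ t) <;>
  simp only [h1, h2, h3, h4, hop, hop', hγ, hm, hm', inv, e1, e2, e3, e4, hc, if_true, if_false,
    map_zero, not_false_eq_true]

theorem heckeOperator_braid (i j : Fin (n - 1)) (hij : (j : ℕ) = i + 1) :
    heckeOperator P i * heckeOperator P j * heckeOperator P i =
      heckeOperator P j * heckeOperator P i * heckeOperator P j := by
  classical
  refine end_ext P fun γ hγ => ?_
  obtain ⟨p, hp⟩ : ∃ p : Fin n, (p : ℕ) = i := ⟨⟨i, by omega⟩, rfl⟩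
  obtain ⟨q, hq⟩ : ∃ q : Fin n, (q : ℕ) = i + 1 := ⟨⟨i + 1, by omega⟩, rfl⟩
  obtain ⟨r, hr⟩ : ∃ r : Fin n, (r : ℕ) = j + 1 := ⟨⟨j + 1, by omega⟩, rfl⟩
  have hq' : (q : ℕ) = j := by omega
  have hop := fun {γ : Equiv.Perm (Fin n)} hγ => heckeOperator_basisVec P hp hq (γ := γ) hγ
  have hm := fun {γ : Equiv.Perm (Fin n)} hγ => simpleTransposition_mul_mem P hp hq (γ := γ) hγ
  have hop' := fun {γ : Equiv.Perm (Fin n)} hγ => heckeOperator_basisVec P hq' hr (γ := γ) hγ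
  have hm' := fun {γ : Equiv.Perm (Fin n)} hγ => simpleTransposition_mul_mem P hq' hr (γ := γ) hγ
  have e1 : simpleTransposition i p = q := Fin.ext (by
    rw [simpleTransposition_apply_val]; split_ifs <;> omega)
  have e2 : simpleTransposition i q = p := Fin.ext (by
    rw [simpleTransposition_apply_val]; split_ifs <;> omega)
  have e3 : simpleTransposition i r = r := Fin.ext (by
    rw [simpleTransposition_apply_val]; split_ifs <;> omega)
  have e4 : simpleTransposition j p = p := Fin.ext (by
    rw [simpleTransposition_apply_val]; split_ifs <;> omega)
  have e5 : simpleTransposition j q = r := Fin.ext (by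
    rw [simpleTransposition_apply_val]; split_ifs <;> omega)
  have e6 : simpleTransposition j r = q := Fin.ext (by
    rw [simpleTransposition_apply_val]; split_ifs <;> omega)
  have hc : simpleTransposition i * (simpleTransposition j * (simpleTransposition i * γ)) =
      simpleTransposition j * (simpleTransposition i * (simpleTransposition j * γ)) := by
    refine Equiv.ext fun x => ?_
    simp only [Equiv.Perm.mul_apply]
    generalize γ x = y
    by_cases hyp : y = p
    · simp only [hyp, e1, e3, e4, e5]
    by_cases hyq : y = q
    · simp only [hyq, e1, e2, e3, e4, e5, e6]
    by_cases hyr : y = r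
    · simp only [hyr, e2, e3, e4, e6]
    rw [Fin.ext_iff] at hyp hyq hyr
    have f1 : simpleTransposition i y = y := Fin.ext (by
      rw [simpleTransposition_apply_val]; split_ifs <;> omega)
    have f2 : simpleTransposition j y = y := Fin.ext (by
      rw [simpleTransposition_apply_val]; split_ifs <;> omega)
    simp only [f1, f2]
  have inv := fun k (δ : Equiv.Perm (Fin n)) (x : Fin n) => simpleTransposition_mul_inv_apply k δ x
  have hqp : (γ⁻¹ q : ℕ) ≠ γ⁻¹ p := fun h => by
    have := γ⁻¹.injective (Fin.ext h); omega
  have hrp : (γ⁻¹ r : ℕ) ≠ γ⁻¹ p := fun h => by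
    have := γ⁻¹.injective (Fin.ext h); omega
  have hrq : (γ⁻¹ r : ℕ) ≠ γ⁻¹ q := fun h => by
    have := γ⁻¹.injective (Fin.ext h); omega
  have hopx : ∀ {δ : Equiv.Perm (Fin n)} (x y : Fin n), δ ∈ linearExtensions P → δ⁻¹ p = x →
      δ⁻¹ q = y → heckeOperator P i (basisVec P δ) = if (y : ℕ) < x then basisVec P δ
        else if P.le x y then 0 else basisVec P (simpleTransposition i * δ) := by
    rintro δ x y hδ rfl rfl
    exact hop hδ
  have hopx' : ∀ {δ : Equiv.Perm (Fin n)} (x y : Fin n), δ ∈ linearExtensions P → δ⁻¹ q = x →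
      δ⁻¹ r = y → heckeOperator P j (basisVec P δ) = if (y : ℕ) < x then basisVec P δ
        else if P.le x y then 0 else basisVec P (simpleTransposition j * δ) := by
    rintro δ x y hδ rfl rfl
    exact hop' hδ
  have mi := (hm hγ).mpr
  have mj := (hm' hγ).mpr
  have mij := fun h => (hm (mj h)).mpr
  have mji := fun h => (hm' (mi h)).mpr
  simp only [inv, e2, e3, e4, e5] at mij mji
  have oi := hop hγ
  have oj := hop' hγ
  have oii := fun h => hopx (γ⁻¹ q) (γ⁻¹ p) (mi h) (by rw [inv, e1]) (by rw [inv, e2])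
  have ojj := fun h => hopx' (γ⁻¹ r) (γ⁻¹ q) (mj h) (by rw [inv, e5]) (by rw [inv, e6])
  have oij := fun h => hopx (γ⁻¹ p) (γ⁻¹ r) (mj h) (by rw [inv, e4]) (by rw [inv, e5])
  have oji := fun h => hopx' (γ⁻¹ p) (γ⁻¹ r) (mi h) (by rw [inv, e2]) (by rw [inv, e3])
  have oiji := fun h h' => hopx (γ⁻¹ q) (γ⁻¹ r) (mji h h')
    (by rw [inv, e4, inv, e1]) (by rw [inv, e5, inv, e3])
  have ojij := fun h h' => hopx' (γ⁻¹ p) (γ⁻¹ q) (mij h h')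
    (by rw [inv, e2, inv, e4]) (by rw [inv, e3, inv, e6])
  rw [hc] at oiji
  simp only [Module.End.mul_apply]
  clear hopx hopx' hop hop' hm hm' mi mj mij mji hc inv hγ
  have zi := map_zero (heckeOperator P i)
  have zj := map_zero (heckeOperator P j)
  generalize heckeOperator P i = A at *
  generalize heckeOperator P j = B at *
  generalize P.le (γ⁻¹ p) (γ⁻¹ q) = R1 at *
  generalize P.le (γ⁻¹ q) (γ⁻¹ r) = R2 at *
  generalize P.le (γ⁻¹ p) (γ⁻¹ r) = R3 at *
  generalize (γ⁻¹ p : ℕ) = a at *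
  generalize (γ⁻¹ q : ℕ) = b at *
  generalize (γ⁻¹ r : ℕ) = c at *
  clear e1 e2 e3 e4 e5 e6 hp hq hr hq' hij
  grind

end Action

/-- The action of the 0-Hecke algebra on the span of `Σ_L(P)`. -/
noncomputable def ZeroHecke.rep {n : ℕ} (P : PartialOrder (Fin n)) :
    ZeroHecke n →ₐ[ℂ] Module.End ℂ (linearExtensions P →₀ ℂ) :=
  RingQuot.liftAlgHom ℂ ⟨FreeAlgebra.lift ℂ (heckeOperator P), fun x y h => by
    induction h with
    | idem i => simpa using heckeOperator_idem P i
    | braid i j h => simpa using heckeOperator_braid P i j h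
    | comm i j h => simpa using heckeOperator_comm P i j h⟩

/-- The left `H_n(0)`-module `M_P`, with underlying space `ℂ Σ_L(P)`. -/
def PosetModule {n : ℕ} (P : PartialOrder (Fin n)) : Type :=
  linearExtensions P →₀ ℂ

noncomputable instance instAddCommGroupPosetModule {n : ℕ} (P : PartialOrder (Fin n)) :
    AddCommGroup (PosetModule P) :=
  inferInstanceAs (AddCommGroup (linearExtensions P →₀ ℂ))

noncomputable instance instModuleZeroHeckePosetModule {n : ℕ} (P : PartialOrder (Fin n)) :
    Module (ZeroHecke n) (PosetModule P) :=
  Module.compHom (linearExtensions P →₀ ℂ) (ZeroHecke.rep P).toRingHom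

theorem ZeroHecke.gen_smul {n : ℕ} (P : PartialOrder (Fin n)) (i : Fin (n - 1))
    (v : PosetModule P) : ZeroHecke.gen i • v = heckeOperator P i v := by
  change ZeroHecke.rep P (ZeroHecke.gen i) v = _
  simp [ZeroHecke.rep, ZeroHecke.gen]

noncomputable instance instModuleComplexPosetModule {n : ℕ} (P : PartialOrder (Fin n)) :
    Module ℂ (PosetModule P) :=
  inferInstanceAs (Module ℂ (linearExtensions P →₀ ℂ))

theorem ZeroHecke.algebraMap_smul {n : ℕ} (P : PartialOrder (Fin n)) (c : ℂ)
    (v : PosetModule P) : algebraMap ℂ (ZeroHecke n) c • v = c • v := by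
  change ZeroHecke.rep P (algebraMap ℂ (ZeroHecke n) c) v = _
  rw [AlgHom.commutes]
  rfl

end RSP

namespace RSP

/-! A linear extension `σ` is a standard tableau on the diagram of `τ_P`, with entry `σ x` in the
box of the label `x`. Regularity forces the labels of each connected component to form an interval.
Since the components are ordered by their least entries, the labels then increase from north-east to
south-west over the whole diagram (`SchurLabeling.IsCanonicalFor.le_of_northeast`). Consecutive
entries of a standard tableau are never in strictly south-east position
(`SchurLabeling.consecutive`), so the boxes of `i` and `i + 1` alone decide whether `i` is a left
descent and whether the two entries may be exchanged. The action thus depends only on tableaux of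
the shape, and equal shapes give isomorphic modules
(`SchurLabeling.IsNortheast.exists_linearEquiv`).

Conversely, the shape is recovered from two invariants of the module. Every tableau is reached
upwards from the row reading tableau, which therefore generates the module, and every tableau leads
upwards to the column reading tableau. A one-dimensional representation of the algebra on which each
generator acts by 0 or 1 is a set `D` of indices acting by 1. Among the sets occurring as quotients
of the module, the least is the descent set of the row reading tableau. Among those occurring as
submodules, the greatest is the descent set of the column reading tableau. Extremality is needed
because several sets can occur. These descent sets show where the row reading changes row and where
the column reading changes column. For a basic shape this gives all row and column lengths, and
these determine the diagram (`SkewPartition.diagram_eq_of_card`). -/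

/-- The box of the label `x`. -/
def SchurLabeling.pos {n : ℕ} (τ : SchurLabeling n) (x : Fin n) : ℕ × ℕ :=
  (τ.filling.symm x).1

/-! ### Labels of regular posets increase from north-east to south-west -/

section Labels

variable {n : ℕ} {τ : SchurLabeling n}

theorem SchurLabeling.pos_mem (τ : SchurLabeling n) (x : Fin n) : τ.pos x ∈ τ.shape.diagram :=
  (τ.filling.symm x).2

theorem SchurLabeling.pos_filling (τ : SchurLabeling n) (b : τ.shape.diagram) :
    τ.pos (τ.filling b) = b.1 := by
  simp [SchurLabeling.pos]

theorem SchurLabeling.pos_injective (τ : SchurLabeling n) : Function.Injective τ.pos :=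
  Subtype.val_injective.comp τ.filling.symm.injective

/-- The labels increase along every north-east to south-west walk inside a component. -/
theorem SchurLabeling.lt_of_northeast_of_reachable (τ : SchurLabeling n) {b b' : τ.shape.diagram}
    (h : τ.shape.boxGraph.Reachable b' b) (hr : b.1.1 ≤ b'.1.1) (hc : b'.1.2 ≤ b.1.2)
    (hne : b ≠ b') : (τ.filling b : ℕ) < τ.filling b' := by
  obtain ⟨k, hk⟩ : ∃ k, b'.1.1 - b.1.1 + (b.1.2 - b'.1.2) = k := ⟨_, rfl⟩
  induction k using Nat.strong_induction_on generalizing b' with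
  | _ k ih =>
    rcases hr.eq_or_lt with hr' | hr'
    · refine τ.row_decreasing b' b hr'.symm (lt_of_le_of_ne hc fun h => hne ?_)
      exact Subtype.ext (Prod.ext hr' h.symm)
    rcases hc.eq_or_lt with hc' | hc'
    · exact τ.col_increasing b b' hc'.symm hr'
    by_cases hright : (b'.1.1, b'.1.2 + 1) ∈ τ.shape.diagram
    · have hlt := τ.row_decreasing b' ⟨_, hright⟩ rfl (Nat.lt_succ_self _)
      have hadj : τ.shape.boxGraph.Adj ⟨_, hright⟩ b' := Or.inl ⟨rfl, Or.inr rfl⟩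
      by_cases he : b = ⟨_, hright⟩
      · rw [he]; exact hlt
      · exact (ih _ (by simp only; omega) (hadj.reachable.trans h) hr hc' he rfl).trans hlt
    by_cases hup : (b'.1.1 - 1, b'.1.2) ∈ τ.shape.diagram
    · have hlt := τ.col_increasing ⟨_, hup⟩ b' rfl (show b'.1.1 - 1 < b'.1.1 by omega)
      have hadj : τ.shape.boxGraph.Adj ⟨_, hup⟩ b' :=
        Or.inr ⟨rfl, Or.inl (show b'.1.1 - 1 + 1 = b'.1.1 by omega)⟩
      by_cases he : b = ⟨_, hup⟩
      · rw [he]; exact hlt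
      · exact (ih _ (by simp only; omega) (hadj.reachable.trans h)
          (show b.1.1 ≤ b'.1.1 - 1 by omega) hc he rfl).trans hlt
    exfalso
    -- If `b'` has no neighbour to the right or above, convexity makes the boxes weakly south-west
    -- of `b'` a union of components. This union contains `b'` but not `b`, which lies in a strictly
    -- higher row.
    have key := τ.shape.eq_of_reachable (fun d => b'.1.1 ≤ d.1.1 ∧ d.1.2 ≤ b'.1.2)
      (fun x y hxy => by
        have hxy' := Prod.le_def.mp hxy
        refine propext ⟨fun hx => ⟨hx.1.trans hxy'.1, ?_⟩, fun hy => ⟨?_, hxy'.2.trans hy.2⟩⟩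
        · by_contra hlt
          have h1 : (x.1.1, b'.1.2 + 1) ∈ τ.shape.diagram :=
            τ.shape.mem_diagram_of_between x.2 y.2 (Prod.le_def.mpr ⟨le_rfl, by simp only; omega⟩)
              (Prod.le_def.mpr ⟨hxy'.1, by simp only; omega⟩)
          exact hright (τ.shape.mem_diagram_of_between b'.2 h1
            (Prod.le_def.mpr ⟨le_rfl, Nat.le_succ _⟩) (Prod.le_def.mpr ⟨hx.1, le_rfl⟩))
        · by_contra hlt
          have h1 : (b'.1.1 - 1, x.1.2) ∈ τ.shape.diagram :=
            τ.shape.mem_diagram_of_between x.2 y.2 (Prod.le_def.mpr ⟨by simp only; omega, le_rfl⟩)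
              (Prod.le_def.mpr ⟨by simp only; omega, hxy'.2⟩)
          exact hup (τ.shape.mem_diagram_of_between h1 b'.2
            (Prod.le_def.mpr ⟨le_rfl, hxy'.2.trans hy.2⟩)
            (Prod.le_def.mpr ⟨Nat.sub_le _ _, le_rfl⟩))) h
    have := key.mp ⟨le_rfl, le_rfl⟩
    omega

/-- For a regular poset, a label outside a component does not separate its labels. -/
theorem SchurLabeling.lt_congr_of_reachable (hreg : IsRegular τ.poset)
    {a b c : τ.shape.diagram} (hab : τ.shape.boxGraph.Reachable a b)
    (hac : ¬ τ.shape.boxGraph.Reachable a c) :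
    (τ.filling a : ℕ) < τ.filling c ↔ (τ.filling b : ℕ) < τ.filling c := by
  -- It suffices to compare boxes `x ≤ y`. The first disjunct settles those in the component of `c`.
  -- Otherwise `c` is incomparable to both, and regularity forbids its label to lie between theirs.
  have key := τ.shape.eq_of_reachable
    (fun d => τ.shape.boxGraph.Reachable d c ∨ (τ.filling d : ℕ) < τ.filling c)
    (fun x y hxy => by
      have hr := τ.shape.reachable_of_le x y hxy
      by_cases hxc : τ.shape.boxGraph.Reachable x c
      · exact propext ⟨fun _ => Or.inl (hr.symm.trans hxc), fun _ => Or.inl hxc⟩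
      have hyc : ¬ τ.shape.boxGraph.Reachable y c := fun h => hxc (hr.trans h)
      have ne : ∀ z : τ.shape.diagram, ¬ τ.shape.boxGraph.Reachable z c →
          (τ.filling z : ℕ) ≠ τ.filling c := fun z hz he => by
        have := τ.filling.injective (Fin.ext he)
        exact hz (this ▸ SimpleGraph.Reachable.refl _)
      have hle : ∀ u v : τ.shape.diagram,
          τ.poset.le (τ.filling u) (τ.filling v) ↔ u.1 ≤ v.1 := fun u v => by
        change (τ.filling.symm (τ.filling u)).1 ≤ (τ.filling.symm (τ.filling v)).1 ↔ _
        simp only [Equiv.symm_apply_apply]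
      have h1 := hreg (τ.filling x) (τ.filling c) (τ.filling y) ((hle x y).mpr hxy)
      rw [hle, hle] at h1
      have h2 : ¬ (x.1 ≤ c.1 ∨ c.1 ≤ y.1) := by
        rintro (h | h)
        · exact hxc (τ.shape.reachable_of_le _ _ h)
        · exact hyc (τ.shape.reachable_of_le _ _ h).symm
      have h3 := ne x hxc
      have h4 := ne y hyc
      have h5 : ¬ _ := fun h => h2 (h1 h)
      simp only [hxc, hyc, false_or, eq_iff_iff]
      omega) hab
  have hbc : ¬ τ.shape.boxGraph.Reachable b c := fun h => hac (hab.trans h)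
  simpa only [hac, hbc, false_or, eq_iff_iff] using key

/-- In the canonical labeling of a regular poset the labels increase from north-east to
south-west. -/
theorem SchurLabeling.IsCanonicalFor.le_of_northeast {P : PartialOrder (Fin n)}
    (hτ : τ.IsCanonicalFor P) (hreg : IsRegular P) {x y : Fin n}
    (hr : (τ.pos x).1 ≤ (τ.pos y).1) (hc : (τ.pos y).2 ≤ (τ.pos x).2) : (x : ℕ) ≤ y := by
  rw [← hτ.poset_eq] at hreg
  rcases eq_or_ne x y with rfl | hne
  · exact le_rfl
  obtain ⟨b, rfl⟩ := τ.filling.surjective x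
  obtain ⟨b', rfl⟩ := τ.filling.surjective y
  rw [τ.pos_filling, τ.pos_filling] at hr hc
  have hbb : b ≠ b' := fun h => hne (congrArg _ h)
  by_cases h : τ.shape.boxGraph.Reachable b b'
  · exact (τ.lt_of_northeast_of_reachable h.symm hr hc hbb).le
  -- In different components, the higher one has the smaller least entry. That entry is below the
  -- label of `b'`, hence so are all labels of its component.
  have h1 := (hτ.row_lt_iff h).mp (lt_of_le_of_ne hr (τ.shape.row_ne h))
  obtain ⟨m, hm, hm'⟩ := τ.minEntry_mem (τ.shape.boxGraph.connectedComponentMk b)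
  rw [SimpleGraph.ConnectedComponent.mem_supp_iff, SimpleGraph.ConnectedComponent.eq] at hm
  have h2 : τ.minEntry (τ.shape.boxGraph.connectedComponentMk b') ≤ τ.filling b' :=
    Nat.sInf_le ⟨b', rfl, rfl⟩
  exact ((SchurLabeling.lt_congr_of_reachable hreg hm fun h' => h (hm.symm.trans h')).mp
    (by omega)).le

end Labels

/-! ### Recovering a diagram from row and column lengths -/

section Shape

/-- A finite convex set of boxes is determined by its row lengths and column lengths. -/
theorem SkewPartition.diagram_eq_of_card {S T : SkewPartition}
    (hrow : ∀ k, (S.diagram.filter fun b => b.1 = k).card = (T.diagram.filter fun b => b.1 = k).card)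
    (hcol : ∀ k, (S.diagram.filter fun b => b.2 = k).card =
      (T.diagram.filter fun b => b.2 = k).card) : S.diagram = T.diagram := by
  -- The columns are compared from left to right, assuming that all columns before `j` agree.
  have key : ∀ j, ∀ i, (i, j) ∈ S.diagram ↔ (i, j) ∈ T.diagram := by
    intro j
    induction j using Nat.strong_induction_on with
    | _ j ih =>
      have row_pos : ∀ {S T : SkewPartition}, (∀ k, (S.diagram.filter fun b => b.1 = k).card =
          (T.diagram.filter fun b => b.1 = k).card) → ∀ i j, (i, j) ∈ S.diagram →
          ∃ c, (i, c) ∈ T.diagram := by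
        intro S T hrow i j h
        have h1 : 0 < (T.diagram.filter fun b => b.1 = i).card := by
          rw [← hrow, Finset.card_pos]
          exact ⟨_, Finset.mem_filter.mpr ⟨h, rfl⟩⟩
        obtain ⟨⟨r, c⟩, hb⟩ := Finset.card_pos.mp h1
        obtain ⟨hb1, rfl⟩ := Finset.mem_filter.mp hb
        exact ⟨c, hb1⟩
      -- In a row begun before column `j`, the row length decides whether the row reaches `j`: if
      -- `T` stopped earlier, its row would be a proper subset of that of `S`.
      have started : ∀ {S T : SkewPartition}, (∀ k, (S.diagram.filter fun b => b.1 = k).card =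
          (T.diagram.filter fun b => b.1 = k).card) →
          (∀ c < j, ∀ i, (i, c) ∈ S.diagram ↔ (i, c) ∈ T.diagram) →
          ∀ i, (∃ c < j, (i, c) ∈ S.diagram) → (i, j) ∈ S.diagram → (i, j) ∈ T.diagram := by
        intro S T hrow ih i ⟨c, hc, hcS⟩ hS
        by_contra hT
        have hcT := (ih c hc i).mp hcS
        have hlt : (T.diagram.filter fun b => b.1 = i) ⊂ (S.diagram.filter fun b => b.1 = i) := by
          refine (Finset.ssubset_iff_of_subset ?_).mpr ⟨(i, j), by simp [hS], by simp [hT]⟩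
          rintro ⟨r, d⟩ hd
          obtain ⟨hd1, rfl⟩ := Finset.mem_filter.mp hd
          refine Finset.mem_filter.mpr ⟨?_, rfl⟩
          rcases lt_or_ge d j with hdj | hdj
          · exact (ih d hdj _).mpr hd1
          · exact absurd (T.mem_diagram_of_between hcT hd1 (Prod.mk_le_mk.mpr ⟨le_rfl, hc.le⟩)
              (Prod.mk_le_mk.mpr ⟨le_rfl, hdj⟩)) hT
        exact absurd (hrow i) (Finset.card_lt_card hlt).ne'
      have ih' : ∀ c < j, ∀ i, (i, c) ∈ T.diagram ↔ (i, c) ∈ S.diagram :=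
        fun c hc i => (ih c hc i).symm
      -- The column `j` of one diagram contains that of the other.
      have upper : ∀ {S T : SkewPartition}, (∀ k, (S.diagram.filter fun b => b.1 = k).card =
          (T.diagram.filter fun b => b.1 = k).card) →
          (∀ c < j, ∀ i, (i, c) ∈ S.diagram ↔ (i, c) ∈ T.diagram) →
          ∀ i i', (i, j) ∈ S.diagram → (i, j) ∉ T.diagram → i ≤ i' → (i', j) ∈ T.diagram →
            (i', j) ∈ S.diagram := by
        intro S T hrow ih i i' hi hi' hle hT
        by_cases hst : ∃ c < j, (i', c) ∈ T.diagram
        · exact started (fun k => (hrow k).symm) (fun c hc i => (ih c hc i).symm) i' hst hT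
        -- A row of `S` not begun before `j` is still nonempty, with boxes at column `j` or later.
        -- Convexity with the box `(i, j)` above forces the row to contain column `j`.
        · obtain ⟨c, hc⟩ := row_pos (fun k => (hrow k).symm) i' j hT
          have hcj : j ≤ c := by
            by_contra h
            exact hst ⟨c, not_le.mp h, (ih c (not_le.mp h) i').mp hc⟩
          exact S.mem_diagram_of_between hi hc (Prod.mk_le_mk.mpr ⟨hle, le_rfl⟩)
            (Prod.mk_le_mk.mpr ⟨le_rfl, hcj⟩)
      have eq_of_sub : ∀ {S T : SkewPartition}, (∀ k, (S.diagram.filter fun b => b.2 = k).card =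
          (T.diagram.filter fun b => b.2 = k).card) →
          (∀ i, (i, j) ∈ S.diagram → (i, j) ∈ T.diagram) →
          ∀ i, (i, j) ∈ S.diagram ↔ (i, j) ∈ T.diagram := by
        intro S T hcol hsub i
        have : (S.diagram.filter fun b => b.2 = j) = (T.diagram.filter fun b => b.2 = j) := by
          refine Finset.eq_of_subset_of_card_le ?_ (hcol j).ge
          rintro ⟨r, d⟩ hd
          obtain ⟨hd1, rfl⟩ := Finset.mem_filter.mp hd
          exact Finset.mem_filter.mpr ⟨hsub r hd1, rfl⟩
        simpa using Finset.ext_iff.mp this (i, j)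
      by_cases hsub : ∀ i, (i, j) ∈ S.diagram → (i, j) ∈ T.diagram
      · exact eq_of_sub hcol hsub
      · push Not at hsub
        obtain ⟨i, hi, hi'⟩ := hsub
        -- If each column had a box missing from the other, the lower of the two boxes would
        -- contradict `upper`. So one column contains the other, and equal column lengths finish.
        refine fun k => (eq_of_sub (fun k => (hcol k).symm) (fun k hk => ?_) k).symm
        by_contra hkS
        rcases le_total i k with h | h
        · exact hkS (upper hrow ih i k hi hi' h hk)
        · exact hi' (upper (fun k => (hrow k).symm) ih' k i hk hkS h hi)
  ext ⟨i, j⟩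
  exact key j i

/-- A monotone sequence without gaps is determined by the places where it increases. -/
theorem eq_of_monotone_of_step {n : ℕ} {f g : Fin n → ℕ} (hf : Monotone f) (hg : Monotone g)
    (hf' : ∀ x, ∀ k < f x, ∃ z, f z = k) (hg' : ∀ x, ∀ k < g x, ∃ z, g z = k)
    (h : ∀ x y : Fin n, (y : ℕ) = x + 1 → (f x < f y ↔ g x < g y)) : f = g := by
  have zero : ∀ f : Fin n → ℕ, Monotone f → (∀ x, ∀ k < f x, ∃ z, f z = k) →
      ∀ x : Fin n, (x : ℕ) = 0 → f x = 0 := by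
    intro f hf hf' x hx
    by_contra h0
    obtain ⟨z, hz⟩ := hf' x 0 (by omega)
    have := hf (Fin.le_def.mpr (by omega) : x ≤ z)
    omega
  have step : ∀ f : Fin n → ℕ, Monotone f → (∀ x, ∀ k < f x, ∃ z, f z = k) →
      ∀ x y : Fin n, (y : ℕ) = x + 1 → f y = f x ∨ f y = f x + 1 := by
    intro f hf hf' x y hxy
    have h1 := hf (Fin.le_def.mpr (by omega) : x ≤ y)
    by_contra h2
    obtain ⟨z, hz⟩ := hf' y (f x + 1) (by omega)
    rcases le_total z x with h3 | h3
    · have := hf h3; omega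
    · have h4 : z ≠ x := fun h => by rw [h] at hz; omega
      have := hf (Fin.le_def.mpr (by
        have := Fin.val_ne_of_ne h4; have := Fin.le_def.mp h3; omega) : y ≤ z)
      omega
  funext x
  obtain ⟨m, hm⟩ := x
  induction m with
  | zero => rw [zero f hf hf' _ rfl, zero g hg hg' _ rfl]
  | succ m ih =>
    have h1 := ih (by omega)
    have h2 := step f hf hf' ⟨m, by omega⟩ ⟨m + 1, hm⟩ rfl
    have h3 := step g hg hg' ⟨m, by omega⟩ ⟨m + 1, hm⟩ rfl
    have h4 := h ⟨m, by omega⟩ ⟨m + 1, hm⟩ rfl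
    omega

end Shape

/-! ### Linear extensions as standard tableaux -/

section Tableaux

variable {n : ℕ} {τ : SchurLabeling n}

/-- The labels increase from north-east to south-west. -/
def SchurLabeling.IsNortheast (τ : SchurLabeling n) : Prop :=
  ∀ x y : Fin n, (τ.pos x).1 ≤ (τ.pos y).1 → (τ.pos y).2 ≤ (τ.pos x).2 → (x : ℕ) ≤ y

theorem SchurLabeling.val_le_of_pos_le {σ : Equiv.Perm (Fin n)}
    (hσ : σ ∈ linearExtensions τ.poset) {x y : Fin n} (h : τ.pos x ≤ τ.pos y) :
    (σ x : ℕ) ≤ σ y :=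
  hσ x y h

/-- Consecutive entries of a standard tableau are never in strictly south-east position. -/
theorem SchurLabeling.consecutive {σ : Equiv.Perm (Fin n)}
    (hσ : σ ∈ linearExtensions τ.poset) {x y : Fin n} (h : (σ y : ℕ) = σ x + 1) :
    ((τ.pos y).1 ≤ (τ.pos x).1 ∧ (τ.pos x).2 < (τ.pos y).2) ∨
      ((τ.pos x).1 < (τ.pos y).1 ∧ (τ.pos y).2 ≤ (τ.pos x).2) := by
  have h1 : ¬ τ.pos y ≤ τ.pos x := fun h' => by
    have := SchurLabeling.val_le_of_pos_le hσ h'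
    omega
  by_contra h2
  rw [Prod.le_def] at h1
  have h3 : (τ.pos x).1 < (τ.pos y).1 ∧ (τ.pos x).2 < (τ.pos y).2 := by omega
  -- By convexity this corner is a box strictly between the other two, but no entry lies strictly
  -- between two consecutive ones.
  let p : ℕ × ℕ := ((τ.pos x).1, (τ.pos y).2)
  have hxp : τ.pos x ≤ p := Prod.le_def.mpr ⟨le_rfl, h3.2.le⟩
  have hpy : p ≤ τ.pos y := Prod.le_def.mpr ⟨h3.1.le, le_rfl⟩
  let z : Fin n := τ.filling ⟨p, τ.shape.mem_diagram_of_between (τ.pos_mem x) (τ.pos_mem y) hxp hpy⟩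
  have hz : τ.pos z = p := τ.pos_filling _
  have h4 := SchurLabeling.val_le_of_pos_le hσ (hz.symm ▸ hxp : τ.pos x ≤ τ.pos z)
  have h5 := SchurLabeling.val_le_of_pos_le hσ (hz.symm ▸ hpy : τ.pos z ≤ τ.pos y)
  rcases (by omega : (σ z : ℕ) = σ x ∨ (σ z : ℕ) = σ y) with h6 | h6
  · have h7 := congrArg Prod.snd hz
    rw [σ.injective (Fin.ext h6)] at h7
    exact h3.2.ne h7
  · have h7 := congrArg Prod.fst hz
    rw [σ.injective (Fin.ext h6)] at h7
    exact h3.1.ne' h7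

/-- By `SchurLabeling.consecutive` one of the two boxes is weakly north-east of the other, and
labels increase in that direction. This removes the labels from the description of descents. -/
theorem SchurLabeling.IsNortheast.lt_iff_row (hτ : τ.IsNortheast) {σ : Equiv.Perm (Fin n)}
    (hσ : σ ∈ linearExtensions τ.poset) {x y : Fin n} (h : (σ y : ℕ) = σ x + 1) :
    (y : ℕ) < x ↔ (τ.pos y).1 ≤ (τ.pos x).1 := by
  have h1 := SchurLabeling.consecutive hσ h
  have h2 := hτ x y
  have h3 := hτ y x
  have h4 : (x : ℕ) ≠ y := fun h' => by
    rw [Fin.ext h'] at h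
    omega
  omega

theorem mem_leftDescents_iff_of_apply {σ : Equiv.Perm (Fin n)} {i : Fin (n - 1)} {x y : Fin n}
    (hx : (σ x : ℕ) = i) (hy : (σ y : ℕ) = i + 1) : i ∈ leftDescents σ ↔ (y : ℕ) < x := by
  rw [mem_leftDescents_iff, Fin.lt_def]
  have h1 : (⟨i, by omega⟩ : Fin n) = σ x := Fin.ext hx.symm
  have h2 : (⟨i + 1, by omega⟩ : Fin n) = σ y := Fin.ext hy.symm
  rw [h1, h2]
  simp

theorem exists_apply_eq (σ : Equiv.Perm (Fin n)) (i : Fin (n - 1)) :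
    ∃ x y, (σ x : ℕ) = i ∧ (σ y : ℕ) = i + 1 :=
  ⟨σ⁻¹ ⟨i, by omega⟩, σ⁻¹ ⟨i + 1, by omega⟩, by simp, by simp⟩

theorem SchurLabeling.IsNortheast.mem_leftDescents_iff_row (hτ : τ.IsNortheast)
    {σ : Equiv.Perm (Fin n)} (hσ : σ ∈ linearExtensions τ.poset) {i : Fin (n - 1)} {x y : Fin n}
    (hx : (σ x : ℕ) = i) (hy : (σ y : ℕ) = i + 1) :
    i ∈ leftDescents σ ↔ (τ.pos y).1 ≤ (τ.pos x).1 := by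
  rw [mem_leftDescents_iff_of_apply hx hy, hτ.lt_iff_row hσ (by omega)]

theorem SchurLabeling.IsNortheast.mem_leftDescents_iff_col (hτ : τ.IsNortheast)
    {σ : Equiv.Perm (Fin n)} (hσ : σ ∈ linearExtensions τ.poset) {i : Fin (n - 1)} {x y : Fin n}
    (hx : (σ x : ℕ) = i) (hy : (σ y : ℕ) = i + 1) :
    i ∈ leftDescents σ ↔ (τ.pos x).2 < (τ.pos y).2 := by
  rw [hτ.mem_leftDescents_iff_row hσ hx hy]
  have := SchurLabeling.consecutive hσ (x := x) (y := y) (by omega)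
  omega

theorem simpleTransposition_mul_mem_iff {P : PartialOrder (Fin n)} {σ : Equiv.Perm (Fin n)}
    (hσ : σ ∈ linearExtensions P) {i : Fin (n - 1)} {x y : Fin n}
    (hx : (σ x : ℕ) = i) (hy : (σ y : ℕ) = i + 1) :
    simpleTransposition i * σ ∈ linearExtensions P ↔ ¬ P.le x y := by
  simpa using simpleTransposition_mul_mem P hx hy hσ

/-- An exchange is blocked only by comparability. Since strictly south-east position is excluded,
this amounts to sharing a row or a column. -/
theorem SchurLabeling.simpleTransposition_mul_mem_iff {σ : Equiv.Perm (Fin n)}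
    (hσ : σ ∈ linearExtensions τ.poset) {i : Fin (n - 1)} {x y : Fin n}
    (hx : (σ x : ℕ) = i) (hy : (σ y : ℕ) = i + 1) :
    simpleTransposition i * σ ∈ linearExtensions τ.poset ↔
      (τ.pos x).1 ≠ (τ.pos y).1 ∧ (τ.pos x).2 ≠ (τ.pos y).2 := by
  rw [RSP.simpleTransposition_mul_mem_iff hσ hx hy]
  change ¬ τ.pos x ≤ τ.pos y ↔ _
  have := SchurLabeling.consecutive hσ (x := x) (y := y) (by omega)
  rw [Prod.le_def]
  omega

/-! ### Row and column reading tableaux -/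

/-- The row reading tableau: boxes are numbered row by row. -/
noncomputable def SchurLabeling.rowReading (τ : SchurLabeling n) : Equiv.Perm (Fin n) :=
  -- `Tuple.sort` sends a rank to the label there, whereas a tableau sends a label to its rank.
  (Tuple.sort fun x => toLex (τ.pos x))⁻¹

/-- The column reading tableau: boxes are numbered column by column. -/
noncomputable def SchurLabeling.colReading (τ : SchurLabeling n) : Equiv.Perm (Fin n) :=
  (Tuple.sort fun x => toLex (τ.pos x).swap)⁻¹

theorem apply_lt_of_lt {α : Type*} [LinearOrder α] {f : Fin n → α} {σ : Equiv.Perm (Fin n)}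
    (hσ : Monotone (f ∘ ⇑σ⁻¹)) {x y : Fin n} (h : f x < f y) : σ x < σ y := by
  by_contra h1
  have := hσ (not_lt.mp h1)
  simp only [Function.comp_apply, Equiv.Perm.coe_inv, Equiv.symm_apply_apply] at this
  exact absurd h (not_lt.mpr this)

theorem perm_eq_of_monotone {α : Type*} [LinearOrder α] {f : Fin n → α}
    (hf : Function.Injective f) {σ ρ : Equiv.Perm (Fin n)}
    (hσ : Monotone (f ∘ ⇑σ⁻¹)) (hρ : Monotone (f ∘ ⇑ρ⁻¹)) : σ = ρ := by
  have h := Tuple.unique_monotone hσ hρ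
  rw [← inv_inj]
  exact Equiv.ext fun x => hf (congrFun h x)

theorem SchurLabeling.monotone_rowReading (τ : SchurLabeling n) :
    Monotone ((fun x => toLex (τ.pos x)) ∘ ⇑(τ.rowReading)⁻¹) := by
  rw [SchurLabeling.rowReading, inv_inv]
  exact Tuple.monotone_sort _

theorem SchurLabeling.monotone_colReading (τ : SchurLabeling n) :
    Monotone ((fun x => toLex (τ.pos x).swap) ∘ ⇑(τ.colReading)⁻¹) := by
  rw [SchurLabeling.colReading, inv_inv]
  exact Tuple.monotone_sort _

theorem SchurLabeling.rowReading_mem (τ : SchurLabeling n) :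
    τ.rowReading ∈ linearExtensions τ.poset := by
  intro x y hxy
  rcases eq_or_ne x y with rfl | hne
  · exact le_rfl
  refine (apply_lt_of_lt τ.monotone_rowReading (x := x) (y := y) ?_).le
  exact lt_of_le_of_ne (Prod.Lex.toLex_mono hxy) fun h => hne (τ.pos_injective (toLex.injective h))

theorem SchurLabeling.colReading_mem (τ : SchurLabeling n) :
    τ.colReading ∈ linearExtensions τ.poset := by
  intro x y hxy
  rcases eq_or_ne x y with rfl | hne
  · exact le_rfl
  refine (apply_lt_of_lt τ.monotone_colReading (x := x) (y := y) ?_).le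
  exact lt_of_le_of_ne (Prod.Lex.toLex_mono (Prod.swap_le_swap.mpr hxy)) fun h =>
    hne (τ.pos_injective (Prod.swap_injective (toLex.injective h)))

theorem SchurLabeling.row_rowReading_mono (τ : SchurLabeling n) :
    Monotone fun i => (τ.pos (τ.rowReading⁻¹ i)).1 := fun _ _ h =>
  Prod.Lex.monotone_fst _ _ (τ.monotone_rowReading h)

theorem SchurLabeling.col_colReading_mono (τ : SchurLabeling n) :
    Monotone fun i => (τ.pos (τ.colReading⁻¹ i)).2 := fun _ _ h =>
  Prod.Lex.monotone_fst _ _ (τ.monotone_colReading h)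

/-- Within a row the entries of any tableau already increase to the right, so monotonicity of the
row index gives the full lexicographic order. -/
theorem SchurLabeling.eq_rowReading {σ : Equiv.Perm (Fin n)}
    (hσ : σ ∈ linearExtensions τ.poset) (h : Monotone fun i => (τ.pos (σ⁻¹ i)).1) :
    σ = τ.rowReading := by
  refine perm_eq_of_monotone (toLex.injective.comp τ.pos_injective) (fun i j hij => ?_)
    τ.monotone_rowReading
  refine Prod.Lex.toLex_le_toLex.mpr ?_
  rcases (h hij).lt_or_eq with h1 | h1
  · exact Or.inl h1
  refine Or.inr ⟨h1, ?_⟩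
  by_contra h2
  have h3 := SchurLabeling.val_le_of_pos_le hσ (x := σ⁻¹ j) (y := σ⁻¹ i)
    (Prod.le_def.mpr ⟨h1.ge, (not_le.mp h2).le⟩)
  simp only [Equiv.Perm.coe_inv, Equiv.apply_symm_apply] at h3
  obtain rfl : i = j := le_antisymm hij h3
  exact h2 le_rfl

theorem SchurLabeling.eq_colReading {σ : Equiv.Perm (Fin n)}
    (hσ : σ ∈ linearExtensions τ.poset) (h : Monotone fun i => (τ.pos (σ⁻¹ i)).2) :
    σ = τ.colReading := by
  refine perm_eq_of_monotone (toLex.injective.comp (Prod.swap_injective.comp τ.pos_injective))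
    (fun i j hij => ?_) τ.monotone_colReading
  refine Prod.Lex.toLex_le_toLex.mpr ?_
  rcases (h hij).lt_or_eq with h1 | h1
  · exact Or.inl h1
  refine Or.inr ⟨h1, ?_⟩
  by_contra h2
  have h3 := SchurLabeling.val_le_of_pos_le hσ (x := σ⁻¹ j) (y := σ⁻¹ i)
    (Prod.le_def.mpr ⟨(not_le.mp h2).le, h1.ge⟩)
  simp only [Equiv.Perm.coe_inv, Equiv.apply_symm_apply] at h3
  obtain rfl : i = j := le_antisymm hij h3
  exact h2 le_rfl

theorem exists_step_lt_of_not_monotone {f : Fin n → ℕ} (hf : ¬ Monotone f) :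
    ∃ (i : Fin (n - 1)), f ⟨i + 1, by omega⟩ < f ⟨i, by omega⟩ := by
  by_contra h
  push Not at h
  apply hf
  rcases n with _ | m
  · intro a; exact a.elim0
  · rw [Fin.monotone_iff_le_succ]
    intro i
    exact h i

/-- Unless the tableau is the row reading, some `i + 1` lies in a strictly higher row than `i`,
hence also strictly to the right. Then `i` is a descent and the exchange is allowed, so every
tableau descends to the row reading one. -/
theorem SchurLabeling.IsNortheast.exists_down (hτ : τ.IsNortheast) {σ : Equiv.Perm (Fin n)}
    (hσ : σ ∈ linearExtensions τ.poset) (hne : σ ≠ τ.rowReading) :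
    ∃ i ∈ leftDescents σ, simpleTransposition i * σ ∈ linearExtensions τ.poset := by
  obtain ⟨i, hi⟩ := exists_step_lt_of_not_monotone fun h => hne (SchurLabeling.eq_rowReading hσ h)
  have hx : (σ (σ⁻¹ ⟨i, by omega⟩) : ℕ) = i := by simp
  have hy : (σ (σ⁻¹ ⟨i + 1, by omega⟩) : ℕ) = i + 1 := by simp
  have hc := SchurLabeling.consecutive hσ (hy.trans (by rw [hx]))
  exact ⟨i, (hτ.mem_leftDescents_iff_row hσ hx hy).mpr (by omega),
    (SchurLabeling.simpleTransposition_mul_mem_iff hσ hx hy).mpr (by omega)⟩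

/-- Here some `i + 1` lies strictly to the left of `i`, hence strictly below it, and the exchange
increases the length. -/
theorem SchurLabeling.IsNortheast.exists_up (hτ : τ.IsNortheast) {σ : Equiv.Perm (Fin n)}
    (hσ : σ ∈ linearExtensions τ.poset) (hne : σ ≠ τ.colReading) :
    ∃ i ∉ leftDescents σ, simpleTransposition i * σ ∈ linearExtensions τ.poset := by
  obtain ⟨i, hi⟩ := exists_step_lt_of_not_monotone fun h => hne (SchurLabeling.eq_colReading hσ h)
  have hx : (σ (σ⁻¹ ⟨i, by omega⟩) : ℕ) = i := by simp
  have hy : (σ (σ⁻¹ ⟨i + 1, by omega⟩) : ℕ) = i + 1 := by simp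
  have hc := SchurLabeling.consecutive hσ (hy.trans (by rw [hx]))
  exact ⟨i, (hτ.mem_leftDescents_iff_col hσ hx hy).not.mpr (by omega),
    (SchurLabeling.simpleTransposition_mul_mem_iff hσ hx hy).mpr (by omega)⟩

/-- The row index is monotone along the reading, so a descent can occur only inside a row, where
exchanges are forbidden. -/
theorem SchurLabeling.IsNortheast.rowReading_not_down (hτ : τ.IsNortheast) {i : Fin (n - 1)}
    (hi : i ∈ leftDescents τ.rowReading) :
    simpleTransposition i * τ.rowReading ∉ linearExtensions τ.poset := by
  obtain ⟨x, y, hx, hy⟩ := exists_apply_eq τ.rowReading i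
  rw [SchurLabeling.simpleTransposition_mul_mem_iff τ.rowReading_mem hx hy]
  have h1 := (hτ.mem_leftDescents_iff_row τ.rowReading_mem hx hy).mp hi
  have h2 := τ.row_rowReading_mono
    (Fin.le_def.mpr (by omega) : τ.rowReading x ≤ τ.rowReading y)
  simp only [Equiv.Perm.coe_inv, Equiv.symm_apply_apply] at h2
  omega

theorem SchurLabeling.IsNortheast.colReading_not_up (hτ : τ.IsNortheast) {i : Fin (n - 1)}
    (hi : i ∉ leftDescents τ.colReading) :
    simpleTransposition i * τ.colReading ∉ linearExtensions τ.poset := by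
  obtain ⟨x, y, hx, hy⟩ := exists_apply_eq τ.colReading i
  rw [SchurLabeling.simpleTransposition_mul_mem_iff τ.colReading_mem hx hy]
  have h1 := (hτ.mem_leftDescents_iff_col τ.colReading_mem hx hy).not.mp hi
  have h2 := τ.col_colReading_mono
    (Fin.le_def.mpr (by omega) : τ.colReading x ≤ τ.colReading y)
  simp only [Equiv.Perm.coe_inv, Equiv.symm_apply_apply] at h2
  omega

theorem SchurLabeling.exists_row_eq (hb : τ.shape.IsBasic) (x : Fin n) {k : ℕ}
    (hk : k < (τ.pos x).1) : ∃ z, (τ.pos z).1 = k := by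
  obtain ⟨c, hc⟩ := hb.row_nonempty k (YoungDiagram.mem_iff_lt_colLen.mp
    (τ.shape.outer.up_left_mem hk.le (Nat.zero_le _) (Finset.mem_sdiff.mp (τ.pos_mem x)).1))
  exact ⟨τ.filling ⟨_, hc⟩, by rw [τ.pos_filling]⟩

theorem SchurLabeling.exists_col_eq (hb : τ.shape.IsBasic) (x : Fin n) {k : ℕ}
    (hk : k < (τ.pos x).2) : ∃ z, (τ.pos z).2 = k := by
  obtain ⟨r, hr⟩ := hb.col_nonempty k (YoungDiagram.mem_iff_lt_rowLen.mp
    (τ.shape.outer.up_left_mem (Nat.zero_le _) hk.le (Finset.mem_sdiff.mp (τ.pos_mem x)).1))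
  exact ⟨τ.filling ⟨_, hr⟩, by rw [τ.pos_filling]⟩

/-- Counting boxes by entry turns row and column lengths into data of the sequences of row and
column indices along a reading. -/
theorem SchurLabeling.card_diagram_filter (τ : SchurLabeling n) (σ : Equiv.Perm (Fin n))
    (f : ℕ × ℕ → ℕ) (k : ℕ) :
    (τ.shape.diagram.filter fun b => f b = k).card =
      (Finset.univ.filter fun i => f (τ.pos (σ⁻¹ i)) = k).card := by
  symm
  refine Finset.card_bij (fun i _ => τ.pos (σ⁻¹ i)) (fun i hi => ?_) (fun i _ j _ h => ?_)
    fun b hb => ?_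
  · exact Finset.mem_filter.mpr ⟨τ.pos_mem _, (Finset.mem_filter.mp hi).2⟩
  · exact σ⁻¹.injective (τ.pos_injective h)
  · obtain ⟨h1, h2⟩ := Finset.mem_filter.mp hb
    have h3 : τ.pos (σ⁻¹ (σ (τ.filling ⟨b, h1⟩))) = b := by
      rw [Equiv.Perm.coe_inv, Equiv.symm_apply_apply, τ.pos_filling]
    exact ⟨σ (τ.filling ⟨b, h1⟩), Finset.mem_filter.mpr ⟨Finset.mem_univ _, by rw [h3, h2]⟩, h3⟩

/-- The descents of the row and the column reading tableau determine the shape. -/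
theorem SchurLabeling.shape_eq_of_leftDescents_eq {τ τ' : SchurLabeling n}
    (hτ : τ.IsNortheast) (hτ' : τ'.IsNortheast)
    (hb : τ.shape.IsBasic) (hb' : τ'.shape.IsBasic)
    (hrow : leftDescents τ.rowReading = leftDescents τ'.rowReading)
    (hcol : leftDescents τ.colReading = leftDescents τ'.colReading) : τ.shape = τ'.shape := by
  -- The row indices along the reading are monotone and, the shape being basic, without gaps. They
  -- rise exactly at the non-descents.
  have r : (fun i => (τ.pos (τ.rowReading⁻¹ i)).1) = fun i => (τ'.pos (τ'.rowReading⁻¹ i)).1 := by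
    refine eq_of_monotone_of_step τ.row_rowReading_mono τ'.row_rowReading_mono
      (fun x k hk => ?_) (fun x k hk => ?_) (fun x y hxy => ?_)
    · obtain ⟨z, hz⟩ := SchurLabeling.exists_row_eq hb _ hk
      exact ⟨τ.rowReading z, by simpa using hz⟩
    · obtain ⟨z, hz⟩ := SchurLabeling.exists_row_eq hb' _ hk
      exact ⟨τ'.rowReading z, by simpa using hz⟩
    · have h1 := hτ.mem_leftDescents_iff_row τ.rowReading_mem (i := ⟨x, by omega⟩)
        (x := τ.rowReading⁻¹ x) (y := τ.rowReading⁻¹ y) (by simp) (by simpa using hxy)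
      have h2 := hτ'.mem_leftDescents_iff_row τ'.rowReading_mem (i := ⟨x, by omega⟩)
        (x := τ'.rowReading⁻¹ x) (y := τ'.rowReading⁻¹ y) (by simp) (by simpa using hxy)
      rw [hrow, h2] at h1
      simpa only [not_le] using h1.not.symm
  -- The column indices instead rise exactly at the descents.
  have c : (fun i => (τ.pos (τ.colReading⁻¹ i)).2) = fun i => (τ'.pos (τ'.colReading⁻¹ i)).2 := by
    refine eq_of_monotone_of_step τ.col_colReading_mono τ'.col_colReading_mono
      (fun x k hk => ?_) (fun x k hk => ?_) (fun x y hxy => ?_)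
    · obtain ⟨z, hz⟩ := SchurLabeling.exists_col_eq hb _ hk
      exact ⟨τ.colReading z, by simpa using hz⟩
    · obtain ⟨z, hz⟩ := SchurLabeling.exists_col_eq hb' _ hk
      exact ⟨τ'.colReading z, by simpa using hz⟩
    · have h1 := hτ.mem_leftDescents_iff_col τ.colReading_mem (i := ⟨x, by omega⟩)
        (x := τ.colReading⁻¹ x) (y := τ.colReading⁻¹ y) (by simp) (by simpa using hxy)
      have h2 := hτ'.mem_leftDescents_iff_col τ'.colReading_mem (i := ⟨x, by omega⟩)
        (x := τ'.colReading⁻¹ x) (y := τ'.colReading⁻¹ y) (by simp) (by simpa using hxy)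
      rw [hcol, h2] at h1
      exact h1.symm
  refine SkewPartition.eq_of_diagram_eq hb hb' (SkewPartition.diagram_eq_of_card (fun k => ?_)
    fun k => ?_)
  · rw [τ.card_diagram_filter τ.rowReading Prod.fst, τ'.card_diagram_filter τ'.rowReading Prod.fst]
    simp only [fun i => congrFun r i]
  · rw [τ.card_diagram_filter τ.colReading Prod.snd, τ'.card_diagram_filter τ'.colReading Prod.snd]
    simp only [fun i => congrFun c i]

end Tableaux

/-! ### Coefficients under the action of a generator -/

section Modules

variable {n : ℕ} {P Q : PartialOrder (Fin n)}

theorem permLength_simpleTransposition_mul_ne (i : Fin (n - 1)) (σ : Equiv.Perm (Fin n)) :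
    permLength (simpleTransposition i * σ) ≠ permLength σ := by
  rw [permLength_eq, permLength_eq]
  rcases inv_lt_or_gt i σ with h | h
  · have := card_inversions_mul i σ h
    omega
  · have := card_inversions_mul_of_gt i σ h
    omega

theorem simpleTransposition_mul_cancel (i : Fin (n - 1)) (σ : Equiv.Perm (Fin n)) :
    simpleTransposition i * (simpleTransposition i * σ) = σ := by
  rw [← mul_assoc, simpleTransposition_mul_self, one_mul]

theorem mem_leftDescents_mul_iff (i : Fin (n - 1)) (σ : Equiv.Perm (Fin n)) :
    i ∈ leftDescents (simpleTransposition i * σ) ↔ i ∉ leftDescents σ := by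
  have := permLength_simpleTransposition_mul_ne i σ
  simp only [leftDescents, Set.mem_ofPred_eq, simpleTransposition_mul_cancel]
  omega

theorem heckeOperator_single_of_mem {i : Fin (n - 1)} (γ : linearExtensions P)
    (h : i ∈ leftDescents γ.1) (c : ℂ) :
    heckeOperator P i (Finsupp.single γ c) = Finsupp.single γ c := by
  simp [heckeOperator, h]

theorem heckeOperator_single_of_mul_mem {i : Fin (n - 1)} (γ : linearExtensions P)
    (h : i ∉ leftDescents γ.1) (h' : simpleTransposition i * γ.1 ∈ linearExtensions P) (c : ℂ) :
    heckeOperator P i (Finsupp.single γ c) =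
      Finsupp.single ⟨simpleTransposition i * γ.1, h'⟩ c := by
  simp [heckeOperator, h, h']

theorem heckeOperator_single_of_mul_notMem {i : Fin (n - 1)} (γ : linearExtensions P)
    (h : i ∉ leftDescents γ.1) (h' : simpleTransposition i * γ.1 ∉ linearExtensions P) (c : ℂ) :
    heckeOperator P i (Finsupp.single γ c) = 0 := by
  simp [heckeOperator, h, h']

/-- The image of `π_i` is spanned by basis elements with descent `i`, because `s_i γ` gains this
descent when `γ` lacks it. -/
theorem heckeOperator_apply_of_notMem {i : Fin (n - 1)} (v : linearExtensions P →₀ ℂ)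
    (δ : linearExtensions P) (h : i ∉ leftDescents δ.1) : heckeOperator P i v δ = 0 := by
  classical
  induction v using Finsupp.induction_linear with
  | zero => simp
  | add v w hv hw => simp [hv, hw]
  | single γ c =>
    by_cases h1 : i ∈ leftDescents γ.1
    · rw [heckeOperator_single_of_mem γ h1, Finsupp.single_apply, if_neg]
      rintro rfl
      exact h h1
    by_cases h2 : simpleTransposition i * γ.1 ∈ linearExtensions P
    · rw [heckeOperator_single_of_mul_mem γ h1 h2, Finsupp.single_apply, if_neg]
      rintro rfl
      exact h ((mem_leftDescents_mul_iff i γ.1).mpr h1)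
    · rw [heckeOperator_single_of_mul_notMem γ h1 h2, Finsupp.zero_apply]

/-- Besides `δ` itself, only `s_i δ` could be sent to `δ`, and it is not a basis element. -/
theorem heckeOperator_apply_of_mul_notMem {i : Fin (n - 1)} (v : linearExtensions P →₀ ℂ)
    (δ : linearExtensions P) (h : i ∈ leftDescents δ.1)
    (h' : simpleTransposition i * δ.1 ∉ linearExtensions P) : heckeOperator P i v δ = v δ := by
  classical
  induction v using Finsupp.induction_linear with
  | zero => simp
  | add v w hv hw => simp [hv, hw]
  | single γ c =>
    by_cases h1 : i ∈ leftDescents γ.1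
    · rw [heckeOperator_single_of_mem γ h1]
    have hne : γ ≠ δ := by
      rintro rfl
      exact h1 h
    rw [Finsupp.single_apply, if_neg hne]
    by_cases h2 : simpleTransposition i * γ.1 ∈ linearExtensions P
    · rw [heckeOperator_single_of_mul_mem γ h1 h2, Finsupp.single_apply, if_neg]
      rintro rfl
      rw [simpleTransposition_mul_cancel] at h'
      exact h' γ.2
    · rw [heckeOperator_single_of_mul_notMem γ h1 h2, Finsupp.zero_apply]

/-- Exactly two basis elements are sent to `s_i γ`: itself and `γ`. -/
theorem heckeOperator_apply_of_mul_mem {i : Fin (n - 1)} (v : linearExtensions P →₀ ℂ)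
    (γ : linearExtensions P) (h : i ∉ leftDescents γ.1)
    (h' : simpleTransposition i * γ.1 ∈ linearExtensions P) :
    heckeOperator P i v ⟨simpleTransposition i * γ.1, h'⟩ =
      v ⟨simpleTransposition i * γ.1, h'⟩ + v γ := by
  classical
  have hd := (mem_leftDescents_mul_iff i γ.1).mpr h
  induction v using Finsupp.induction_linear with
  | zero => simp
  | add v w hv hw =>
    simp only [map_add, Finsupp.add_apply, hv, hw]
    ring
  | single ε c =>
    by_cases h1 : i ∈ leftDescents ε.1
    · have hne : ε ≠ γ := by
        rintro rfl
        exact h h1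
      rw [heckeOperator_single_of_mem ε h1, Finsupp.single_apply (a' := γ), if_neg hne, add_zero]
    have hne : ε ≠ ⟨simpleTransposition i * γ.1, h'⟩ := by
      rintro rfl
      exact h1 hd
    rw [Finsupp.single_apply, Finsupp.single_apply, if_neg hne, zero_add]
    by_cases h2 : simpleTransposition i * ε.1 ∈ linearExtensions P
    · rw [heckeOperator_single_of_mul_mem ε h1 h2, Finsupp.single_apply]
      simp only [mul_right_inj, Subtype.ext_iff]
    · rw [heckeOperator_single_of_mul_notMem ε h1 h2, Finsupp.zero_apply, if_neg]
      rintro rfl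
      exact h2 h'

/-! ### One-dimensional quotients and submodules -/

open Classical in
/-- A linear functional through which `π_i` acts by `1` if `i ∈ D` and by `0` otherwise. -/
def IsCocharacter (D : Set (Fin (n - 1))) (φ : (linearExtensions P →₀ ℂ) →ₗ[ℂ] ℂ) : Prop :=
  ∀ i v, φ (heckeOperator P i v) = if i ∈ D then φ v else 0

open Classical in
/-- A vector on which `π_i` acts by `1` if `i ∈ D` and by `0` otherwise. -/
def IsCharacterVector (D : Set (Fin (n - 1))) (v : linearExtensions P →₀ ℂ) : Prop :=
  ∀ i, heckeOperator P i v = if i ∈ D then v else 0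

variable {τ : SchurLabeling n}

/-- No other tableau moves up to the row reading one, so each generator either preserves its
coefficient or kills it. -/
theorem SchurLabeling.IsNortheast.isCocharacter_rowReading (hτ : τ.IsNortheast) :
    IsCocharacter (P := τ.poset) (leftDescents τ.rowReading)
      (Finsupp.lapply ⟨τ.rowReading, τ.rowReading_mem⟩) := by
  intro i v
  simp only [Finsupp.lapply_apply]
  split_ifs with h
  · exact heckeOperator_apply_of_mul_notMem v ⟨τ.rowReading, τ.rowReading_mem⟩ h
      (hτ.rowReading_not_down h)
  · exact heckeOperator_apply_of_notMem v ⟨τ.rowReading, τ.rowReading_mem⟩ h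

/-- The column reading tableau cannot move up, so each generator fixes it or sends it to 0. -/
theorem SchurLabeling.IsNortheast.isCharacterVector_colReading (hτ : τ.IsNortheast) :
    IsCharacterVector (P := τ.poset) (leftDescents τ.colReading)
      (Finsupp.single ⟨τ.colReading, τ.colReading_mem⟩ 1) := by
  intro i
  split_ifs with h
  · exact heckeOperator_single_of_mem ⟨τ.colReading, τ.colReading_mem⟩ h 1
  · exact heckeOperator_single_of_mul_notMem ⟨τ.colReading, τ.colReading_mem⟩ h
      (hτ.colReading_not_up h) 1

/-- The descent set of the row reading tableau is the least set with a nonzero cocharacter. -/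
theorem SchurLabeling.IsNortheast.leftDescents_rowReading_subset (hτ : τ.IsNortheast)
    {D : Set (Fin (n - 1))} {φ : (linearExtensions τ.poset →₀ ℂ) →ₗ[ℂ] ℂ}
    (hφ : IsCocharacter D φ) (h0 : φ ≠ 0) : leftDescents τ.rowReading ⊆ D := by
  have hrow : φ (Finsupp.single ⟨τ.rowReading, τ.rowReading_mem⟩ 1) ≠ 0 := by
    intro hrow
    have key : ∀ k, ∀ γ : linearExtensions τ.poset, permLength γ.1 = k →
        φ (Finsupp.single γ 1) = 0 := by
      intro k
      induction k using Nat.strong_induction_on with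
      | _ k ih =>
        intro γ hk
        by_cases hγ : γ.1 = τ.rowReading
        · obtain rfl : γ = ⟨τ.rowReading, τ.rowReading_mem⟩ := Subtype.ext hγ
          exact hrow
        obtain ⟨i, hi, hm⟩ := hτ.exists_down γ.2 hγ
        -- Since `γ = π_i (s_i γ)`, the value at `γ` is either 0 or the value at the shorter tableau
        -- `s_i γ`.
        have h1 := hφ i (Finsupp.single ⟨_, hm⟩ 1)
        rw [heckeOperator_single_of_mul_mem ⟨_, hm⟩
          ((mem_leftDescents_mul_iff i γ.1).not.mpr (not_not.mpr hi))
          (by simpa only [simpleTransposition_mul_cancel] using γ.2)] at h1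
        simp only [simpleTransposition_mul_cancel] at h1
        rw [h1, ih _ (by rw [← hk]; exact hi) ⟨_, hm⟩ rfl, ite_self]
    exact h0 (Finsupp.lhom_ext' fun γ => LinearMap.ext_ring (key _ γ rfl))
  intro i hi
  have h1 := hφ i (Finsupp.single ⟨τ.rowReading, τ.rowReading_mem⟩ 1)
  rw [heckeOperator_single_of_mem ⟨τ.rowReading, τ.rowReading_mem⟩ hi] at h1
  by_contra h2
  rw [if_neg h2] at h1
  exact hrow h1

/-- The descent set of the column reading tableau is the greatest set with a nonzero character
vector. -/
theorem SchurLabeling.IsNortheast.subset_leftDescents_colReading (hτ : τ.IsNortheast)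
    {D : Set (Fin (n - 1))} {v : linearExtensions τ.poset →₀ ℂ}
    (hv : IsCharacterVector D v) (h0 : v ≠ 0) : D ⊆ leftDescents τ.colReading := by
  have hcol : v ⟨τ.colReading, τ.colReading_mem⟩ ≠ 0 := by
    intro hcol
    -- The induction runs upwards in length. Any upper bound for the length will do; it keeps the
    -- truncated difference strictly decreasing.
    have bound : ∀ σ : Equiv.Perm (Fin n), permLength σ ≤ Fintype.card (Fin n × Fin n) :=
      fun σ => permLength_eq σ ▸ Finset.card_le_univ _
    have key : ∀ k, ∀ γ : linearExtensions τ.poset,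
        Fintype.card (Fin n × Fin n) - permLength γ.1 = k → v γ = 0 := by
      intro k
      induction k using Nat.strong_induction_on with
      | _ k ih =>
        intro γ hk
        by_cases hγ : γ.1 = τ.colReading
        · obtain rfl : γ = ⟨τ.colReading, τ.colReading_mem⟩ := Subtype.ext hγ
          exact hcol
        obtain ⟨i, hi, hm⟩ := hτ.exists_up γ.2 hγ
        -- The coefficient of `π_i v` at `s_i γ` is the sum of those of `v` at `s_i γ` and `γ`. It
        -- is also 0 or the coefficient of `v` at `s_i γ`, which vanishes by induction.
        have h1 := heckeOperator_apply_of_mul_mem v γ hi hm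
        have h2 : permLength γ.1 < permLength (simpleTransposition i * γ.1) :=
          lt_of_le_of_ne (not_lt.mp hi) (permLength_simpleTransposition_mul_ne i γ.1).symm
        have h3 := bound (simpleTransposition i * γ.1)
        have h4 := ih (Fintype.card (Fin n × Fin n) - permLength (simpleTransposition i * γ.1))
          (by omega) ⟨_, hm⟩ rfl
        rw [hv i, h4, zero_add] at h1
        rw [← h1]
        split_ifs
        · exact h4
        · rfl
    exact h0 (Finsupp.ext fun γ => key _ γ rfl)
  intro i hi
  by_contra h2
  have h1 := heckeOperator_apply_of_notMem v ⟨τ.colReading, τ.colReading_mem⟩ h2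
  rw [hv i, if_pos hi] at h1
  exact hcol h1

/-! ### Module isomorphisms and relabelings -/

/-- Isomorphisms of the modules are the linear isomorphisms that commute with the generators. -/
theorem nonempty_linearEquiv_iff :
    Nonempty (PosetModule P ≃ₗ[ZeroHecke n] PosetModule Q) ↔
      ∃ f : (linearExtensions P →₀ ℂ) ≃ₗ[ℂ] (linearExtensions Q →₀ ℂ),
        ∀ i v, f (heckeOperator P i v) = heckeOperator Q i (f v) := by
  constructor
  · rintro ⟨f⟩
    have smul : ∀ (c : ℂ) (v : PosetModule P), f (c • v) = c • f v := fun c v => by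
      rw [← ZeroHecke.algebraMap_smul, ← ZeroHecke.algebraMap_smul, f.map_smul]
    exact ⟨{ f with map_smul' := smul }, fun i v =>
      (congrArg f (ZeroHecke.gen_smul P i v)).symm.trans
        ((f.map_smul _ _).trans (ZeroHecke.gen_smul Q i (f v)))⟩
  · rintro ⟨f, hf⟩
    -- Every algebra element lifts to the free algebra, where commutation extends from the
    -- generators to all expressions.
    have key : ∀ a (v : linearExtensions P →₀ ℂ),
        f (ZeroHecke.rep P (RingQuot.mkAlgHom ℂ (HeckeRel n) a) v) =
          ZeroHecke.rep Q (RingQuot.mkAlgHom ℂ (HeckeRel n) a) (f v) := by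
      intro a v
      induction a using FreeAlgebra.induction generalizing v with
      | grade0 c =>
        simp only [AlgHom.commutes, Module.algebraMap_end_apply]
        exact f.map_smul c v
      | grade1 i =>
        simp only [ZeroHecke.rep, RingQuot.liftAlgHom_mkAlgHom_apply, FreeAlgebra.lift_ι_apply]
        exact hf i v
      | mul a b ha hb => simp only [map_mul, Module.End.mul_apply, ha, hb]
      | add a b ha hb => simp only [map_add, LinearMap.add_apply, ha, hb]
    refine ⟨{ f with map_smul' := fun a v => ?_ }⟩
    obtain ⟨a, rfl⟩ := RingQuot.mkAlgHom_surjective ℂ (HeckeRel n) a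
    exact key a v

theorem IsCocharacter.comp_symm {D : Set (Fin (n - 1))}
    {φ : (linearExtensions P →₀ ℂ) →ₗ[ℂ] ℂ} (hφ : IsCocharacter D φ)
    (f : (linearExtensions P →₀ ℂ) ≃ₗ[ℂ] (linearExtensions Q →₀ ℂ))
    (hf : ∀ i v, f (heckeOperator P i v) = heckeOperator Q i (f v)) :
    IsCocharacter D (φ ∘ₗ f.symm.toLinearMap) := by
  intro i v
  obtain ⟨w, rfl⟩ := f.surjective v
  simp only [LinearMap.comp_apply, LinearEquiv.coe_coe, ← hf, LinearEquiv.symm_apply_apply]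
  exact hφ i w

theorem IsCharacterVector.map {D : Set (Fin (n - 1))} {v : linearExtensions P →₀ ℂ}
    (hv : IsCharacterVector D v)
    (f : (linearExtensions P →₀ ℂ) ≃ₗ[ℂ] (linearExtensions Q →₀ ℂ))
    (hf : ∀ i v, f (heckeOperator P i v) = heckeOperator Q i (f v)) :
    IsCharacterVector D (f v) := by
  intro i
  rw [← hf, hv i]
  split_ifs
  · rfl
  · exact map_zero f

/-- The cocharacter and the character vector for `τ` are carried across, and extremality is applied
on the side of `τ'`. The reverse inclusions come from the inverse isomorphism. -/
theorem SchurLabeling.IsNortheast.leftDescents_reading_subset {τ τ' : SchurLabeling n}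
    (hτ : τ.IsNortheast) (hτ' : τ'.IsNortheast)
    (f : (linearExtensions τ.poset →₀ ℂ) ≃ₗ[ℂ] (linearExtensions τ'.poset →₀ ℂ))
    (hf : ∀ i v, f (heckeOperator τ.poset i v) = heckeOperator τ'.poset i (f v)) :
    leftDescents τ'.rowReading ⊆ leftDescents τ.rowReading ∧
      leftDescents τ.colReading ⊆ leftDescents τ'.colReading := by
  constructor
  · refine hτ'.leftDescents_rowReading_subset (hτ.isCocharacter_rowReading.comp_symm f hf)
      fun h => ?_
    have := LinearMap.congr_fun h (f (Finsupp.single ⟨τ.rowReading, τ.rowReading_mem⟩ 1))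
    simp at this
  · refine hτ'.subset_leftDescents_colReading (hτ.isCharacterVector_colReading.map f hf) fun h => ?_
    exact one_ne_zero (Finsupp.single_eq_zero.mp (f.map_eq_zero_iff.mp h))

theorem SchurLabeling.exists_perm_of_shape_eq {τ τ' : SchurLabeling n}
    (h : τ.shape = τ'.shape) : ∃ e : Equiv.Perm (Fin n), ∀ x, τ'.pos (e x) = τ.pos x := by
  rcases τ with ⟨S, f, hf, hf'⟩
  rcases τ' with ⟨T, g, hg, hg'⟩
  obtain rfl : S = T := h
  exact ⟨f.symm.trans g, fun x => by simp [SchurLabeling.pos]⟩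

/-- Relabelings of a shape that increase from north-east to south-west give isomorphic modules. -/
theorem SchurLabeling.IsNortheast.exists_linearEquiv {τ τ' : SchurLabeling n}
    (hτ : τ.IsNortheast) (hτ' : τ'.IsNortheast) (h : τ.shape = τ'.shape) :
    ∃ f : (linearExtensions τ.poset →₀ ℂ) ≃ₗ[ℂ] (linearExtensions τ'.poset →₀ ℂ),
      ∀ i v, f (heckeOperator τ.poset i v) = heckeOperator τ'.poset i (f v) := by
  obtain ⟨e, he⟩ := SchurLabeling.exists_perm_of_shape_eq h
  have hle : ∀ x y, τ'.poset.le (e x) (e y) ↔ τ.poset.le x y := fun x y => by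
    change τ'.pos (e x) ≤ τ'.pos (e y) ↔ τ.pos x ≤ τ.pos y
    rw [he, he]
  have mem : ∀ σ : Equiv.Perm (Fin n),
      σ ∈ linearExtensions τ.poset ↔ σ * e⁻¹ ∈ linearExtensions τ'.poset := by
    intro σ
    constructor
    · intro hσ x y hxy
      obtain ⟨x, rfl⟩ := e.surjective x
      obtain ⟨y, rfl⟩ := e.surjective y
      simpa using hσ x y ((hle x y).mp hxy)
    · intro hσ x y hxy
      simpa using hσ (e x) (e y) ((hle x y).mpr hxy)
  -- Right multiplication by `e⁻¹` only renames the labels: both permutations put the same entry in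
  -- each box. It also commutes with left multiplication by `s_i`.
  let E : linearExtensions τ.poset ≃ linearExtensions τ'.poset :=
    (Equiv.mulRight e⁻¹).subtypeEquiv mem
  have hE : ∀ γ, (E γ).1 = γ.1 * e⁻¹ := fun γ => rfl
  have des : ∀ (γ : linearExtensions τ.poset) (i : Fin (n - 1)),
      i ∈ leftDescents (E γ).1 ↔ i ∈ leftDescents γ.1 := by
    intro γ i
    obtain ⟨x, y, hx, hy⟩ := exists_apply_eq γ.1 i
    -- Both descent conditions compare the rows of the same two boxes.
    rw [hτ.mem_leftDescents_iff_row γ.2 hx hy, hτ'.mem_leftDescents_iff_row (E γ).2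
      (x := e x) (y := e y) (by simpa [hE] using hx) (by simpa [hE] using hy), he, he]
  refine ⟨Finsupp.domLCongr E, fun i v => ?_⟩
  induction v using Finsupp.induction_linear with
  | zero => simp only [map_zero]
  | add v w hv hw => simp only [map_add, hv, hw]
  | single γ c =>
    rw [Finsupp.domLCongr_single]
    by_cases h1 : i ∈ leftDescents γ.1
    · rw [heckeOperator_single_of_mem γ h1, heckeOperator_single_of_mem (E γ) ((des γ i).mpr h1),
        Finsupp.domLCongr_single]
    have h1' := (des γ i).not.mpr h1
    have h2' := mem (simpleTransposition i * γ.1)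
    rw [mul_assoc, ← hE] at h2'
    by_cases h2 : simpleTransposition i * γ.1 ∈ linearExtensions τ.poset
    · rw [heckeOperator_single_of_mul_mem γ h1 h2,
        heckeOperator_single_of_mul_mem (E γ) h1' (h2'.mp h2), Finsupp.domLCongr_single]
      congr 1
    · rw [heckeOperator_single_of_mul_notMem γ h1 h2,
        heckeOperator_single_of_mul_notMem (E γ) h1' (h2'.not.mp h2), map_zero]

end Modules

/-! ### Conclusion for canonical labelings -/

theorem SchurLabeling.IsCanonicalFor.isNortheast {n : ℕ} {τ : SchurLabeling n}
    {P : PartialOrder (Fin n)} (hτ : τ.IsCanonicalFor P) (hreg : IsRegular P) : τ.IsNortheast :=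
  fun _ _ => hτ.le_of_northeast hreg

theorem SchurLabeling.IsCanonicalFor.nonempty_linearEquiv_iff {n : ℕ} {τ τ' : SchurLabeling n}
    {P Q : PartialOrder (Fin n)} (hτ : τ.IsCanonicalFor P) (hP : IsRegular P)
    (hτ' : τ'.IsCanonicalFor Q) (hQ : IsRegular Q) :
    Nonempty (PosetModule P ≃ₗ[ZeroHecke n] PosetModule Q) ↔ τ.shape = τ'.shape := by
  have hne := hτ.isNortheast hP
  have hne' := hτ'.isNortheast hQ
  obtain rfl := hτ.poset_eq
  obtain rfl := hτ'.poset_eq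
  rw [RSP.nonempty_linearEquiv_iff]
  refine ⟨fun ⟨f, hf⟩ => ?_, hne.exists_linearEquiv hne'⟩
  have h1 := hne.leftDescents_reading_subset hne' f hf
  have h2 := hne'.leftDescents_reading_subset hne f.symm fun i v => by
    obtain ⟨w, rfl⟩ := f.surjective v
    rw [← hf, f.symm_apply_apply, f.symm_apply_apply]
  exact SchurLabeling.shape_eq_of_leftDescents_eq hne hne' hτ.basic hτ'.basic
    (h2.1.antisymm h1.1) (h1.2.antisymm h2.2)

end RSP

theorem theorem5p4 (n : ℕ) (P Q : PartialOrder (Fin n))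
    (hPreg : RSP.IsRegular P) (hP : RSP.IsSchurLabeledSkewShape P)
    (hQreg : RSP.IsRegular Q) (hQ : RSP.IsSchurLabeledSkewShape Q) :
    Nonempty (RSP.PosetModule P ≃ₗ[RSP.ZeroHecke n] RSP.PosetModule Q) ↔
      (RSP.schurLabelingOf P hP).shape = (RSP.schurLabelingOf Q hQ).shape :=
  (RSP.schurLabelingOf_isCanonicalFor P hP).nonempty_linearEquiv_iff hPreg
    (RSP.schurLabelingOf_isCanonicalFor Q hQ) hQreg
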